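/- Identify $\mathbb{R}^2$ with $\mathbb{C}$. Fix an integer $\ell\ge 1$ and a constant $D\ge 0$. For $N\ge 2$ let $\Psi_{\rm Lau}(z_1,\dots,z_N)=c_{\rm Lau}\prod_{1\le i<j\le N}(z_i-z_j)^\ell\, e^{-\sum_{j=1}^N|z_j|^2/2}$ be the Laughlin state, normalized in $L^2(\mathbb{R}^{2N})$. Let $\mathcal{V}_2^D$ be the set of functions $$F(z_1,\dots,z_N)=\prod_{j=1}^N f_1(z_j)\prod_{1\le i<j\le N}f_2(z_i,z_j),$$ where $f_1$ is a polynomial in one complex variable with $\deg f_1\le DN$, and $f_2$ is a symmetric polynomial in two complex variables whose degree in each variable separately is at most $D$ (both may depend on $N$). For $F\in\mathcal{V}_2^D$, $F\not\equiv 0$, let $\Psi_F=c_F\Psi_{\rm Lau}F$ with $c_F$ chosen such that $\|\Psi_F\|_{L^2(\mathbb{R}^{2N})}=1$, and let $\rho_{\Psi}(z)=\int_{\mathbb{R}^{2(N-1)}}|\Psi(z,z_2,\dots,z_N)|^2\,dz_2\cdots dz_N$ be the one-particle density. **Theorem (weak incompressibility estimate for the Laughlin phase).** Let $V\in C^2(\mathbb{R}^2)$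 be real-valued with $\min_{|x|\ge R}V(x)\to\infty$ as $R\to\infty$. Define $$\mathcal{E}_N[\Psi]=(N-1)\int_{\mathbb{R}^2}V(x)\,\rho_\Psi\big(\sqrt{N-1}\,x\big)\,dx\in(-\infty,+\infty],\qquad E_2^D(N)=\inf\{\mathcal{E}_N[\Psi_F]:\ F\in\mathcal{V}_2^D,\ F\not\equiv0\},$$ and the bath-tub energy $$E_V(\ell)=\inf\Big\{\int_{\mathbb{R}^2}V\rho\ :\ \rho\in L^1(\mathbb{R}^2),\ 0\le\rho\le\frac1{\pi\ell},\ \int_{\mathbb{R}^2}\rho=1\Big\}.$$ Then $$\liminf_{N\to\infty}E_2^D(N)\ \ge\ E_V(\ell).$$ -/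

import Mathlib

open MeasureTheory Filter Topology

noncomputable section

namespace LaughlinPhase

/-- The integral of a real function over the plane `ℝ² = ℂ` (Lebesgue measure) as an extended
real number: integral of the positive part minus integral of the negative part.  It is only used
for functions whose negative part is integrable, so the value lies in `(-∞, +∞]`. -/
def extIntegral (f : ℂ → ℝ) : EReal :=
  ((∫⁻ x, ENNReal.ofReal (f x) : ENNReal) : EReal)
    - ((∫⁻ x, ENNReal.ofReal (-f x) : ENNReal) : EReal)

/-- The Gaussian factor `exp (-∑ⱼ |zⱼ|² / 2)` (magnetic field `2`). -/
def gaussian (N : ℕ) (z : Fin N → ℂ) : ℝ :=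
  Real.exp (-∑ j, ‖z j‖ ^ 2 / 2)

/-- Membership in the `N`-body bosonic Bargmann space: holomorphic, symmetric, and square
integrable against the Gaussian weight. -/
def IsBargmann (N : ℕ) (F : (Fin N → ℂ) → ℂ) : Prop :=
  Differentiable ℂ F ∧
  (∀ (σ : Equiv.Perm (Fin N)) (z : Fin N → ℂ), F (fun j => z (σ j)) = F z) ∧
  MemLp (fun z => F z * (gaussian N z : ℂ)) 2 volume

/-- The Laughlin function `∏_{i<j} (zᵢ - zⱼ)^ℓ exp (-∑ⱼ |zⱼ|² / 2)` before normalization. -/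
def laughlinUnnormalized (ℓ N : ℕ) (z : Fin N → ℂ) : ℂ :=
  (∏ i : Fin N, ∏ j ∈ Finset.Ioi i, (z i - z j) ^ ℓ) * (gaussian N z : ℂ)

/-- The Laughlin state, normalized in `L²(ℝ^{2N})`. -/
def laughlin (ℓ N : ℕ) (z : Fin N → ℂ) : ℂ :=
  ((eLpNorm (laughlinUnnormalized ℓ N) 2 volume).toReal : ℂ)⁻¹ * laughlinUnnormalized ℓ N z

/-- The set of correlation factors `F = ∏ⱼ f₁(zⱼ) ∏_{i<j} f₂(zᵢ, zⱼ)` with polynomials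
`f₁`, `f₂`, where `deg f₁ ≤ D N`, and `f₂` is symmetric of degree at most `D` in each of its two
variables (symmetry of `f₂` is part of being in the two-body Bargmann space). -/
def twoBodyFactors (D : ℝ) (N : ℕ) : Set ((Fin N → ℂ) → ℂ) :=
  {F | IsBargmann N F ∧
    ∃ (f₁ : Polynomial ℂ) (f₂ : MvPolynomial (Fin 2) ℂ),
      IsBargmann 1 (fun z => f₁.eval (z 0)) ∧
      IsBargmann 2 (fun z => MvPolynomial.eval z f₂) ∧
      (f₁.natDegree : ℝ) ≤ D * N ∧
      (∀ i, (f₂.degreeOf i : ℝ) ≤ D) ∧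
      ∀ z, F z = (∏ j, f₁.eval (z j)) *
        ∏ i : Fin N, ∏ j ∈ Finset.Ioi i, MvPolynomial.eval ![z i, z j] f₂}

/-- The `L²`-normalized fully correlated states `Ψ_F = c_F Ψ_Lau F`. -/
def correlatedStates (ℓ : ℕ) (D : ℝ) (N : ℕ) : Set ((Fin N → ℂ) → ℂ) :=
  {Ψ | ∃ F ∈ twoBodyFactors D N, ∃ c : ℂ,
    (∀ z, Ψ z = c * laughlin ℓ N z * F z) ∧ eLpNorm Ψ 2 volume = 1}

/-- The one-particle density `ρ_Ψ(z) = ∫ |Ψ(z, z₂, …, z_N)|² dz₂ ⋯ dz_N`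
(the value for `N = 0` is a dummy). -/
def oneBodyDensity : {N : ℕ} → ((Fin N → ℂ) → ℂ) → ℂ → ℝ
  | 0, _, _ => 0
  | n + 1, Ψ, z => ∫ w : Fin n → ℂ, ‖Ψ (Fin.cons z w : Fin (n + 1) → ℂ)‖ ^ 2

/-- The scaled potential energy `(N-1) ∫ V(x) ρ_Ψ(√(N-1) x) dx`. -/
def scaledEnergy (V : ℂ → ℝ) {N : ℕ} (Ψ : (Fin N → ℂ) → ℂ) : EReal :=
  extIntegral fun x =>
    ((N : ℝ) - 1) * (V x * oneBodyDensity Ψ ((Real.sqrt ((N : ℝ) - 1) : ℂ) * x))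

/-- The ground state energy `E₂^D(N)`: the infimum of the scaled energy over the states `Ψ_F`. -/
def groundEnergy (V : ℂ → ℝ) (ℓ : ℕ) (D : ℝ) (N : ℕ) : EReal :=
  ⨅ Ψ ∈ correlatedStates ℓ D N, scaledEnergy V Ψ

/-- Densities `ρ ∈ L¹(ℝ²)` with `0 ≤ ρ ≤ 1/(πℓ)` and `∫ ρ = 1`. -/
def bathTubDensities (ℓ : ℕ) : Set (ℂ → ℝ) :=
  {ρ | Integrable ρ volume ∧ (∀ᵐ x, 0 ≤ ρ x ∧ ρ x ≤ 1 / (Real.pi * ℓ)) ∧ ∫ x, ρ x = 1}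

/-- The bath-tub energy `E_V(ℓ)`. -/
def bathTubEnergy (V : ℂ → ℝ) (ℓ : ℕ) : EReal :=
  ⨅ ρ ∈ bathTubDensities ℓ, extIntegral fun x => V x * ρ x

end LaughlinPhase

end

open MeasureTheory Filter Topology

noncomputable section

namespace LaughlinPhase

section

open Complex ComplexConjugate

lemma norm_sq_expand (x y : ℂ) :
    ‖y‖ ^ 2 = ‖x‖ ^ 2 + 2 * (conj x * (y - x)).re + ‖y - x‖ ^ 2 := by
  have h : y = x + (y - x) := by ring
  conv_lhs => rw [h]
  simp only [← Complex.normSq_eq_norm_sq, Complex.normSq_add, Complex.mul_re, Complex.conj_re,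
    Complex.conj_im]
  ring

lemma norm_exp_neg_conj_mul (x y : ℂ) :
    ‖Complex.exp (-(conj x * (y - x)))‖ * Real.exp (-(‖x‖ ^ 2 / 2) - ‖y - x‖ ^ 2 / 2)
      = Real.exp (-(‖y‖ ^ 2 / 2)) := by
  rw [Complex.norm_exp, ← Real.exp_add]
  congr 1
  rw [norm_sq_expand x y, Complex.neg_re]
  ring

/-- Moving a point of an analytic plasma to a suitable point of a circle around it gains at least
the screened interaction with the points inside the circle. -/
theorem exists_sphere_gain {ι : Type*} (s : Finset ι) (p : ι → ℂ) (l : ℕ) (H : ℂ → ℂ)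
    (hH : Differentiable ℂ H) (x : ℂ) {r : ℝ} (hr : 0 < r) :
    ∃ y : ℂ, ‖(∏ j ∈ s, (x - p j) ^ l) * H x‖ * Real.exp (-(‖x‖ ^ 2 / 2)) *
        (∏ j ∈ s, max 1 (r / ‖x - p j‖) ^ l) * Real.exp (-(r ^ 2 / 2)) ≤
      ‖(∏ j ∈ s, (y - p j) ^ l) * H y‖ * Real.exp (-(‖y‖ ^ 2 / 2)) := by
  classical
  set b : ι → ℂ → ℂ := fun j y =>
    if ‖p j - x‖ < r then (r ^ 2 - conj (p j - x) * (y - x)) / r else y - p j with hb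
  have hbd : ∀ j, Differentiable ℂ (b j) := by
    intro j
    by_cases h : ‖p j - x‖ < r
    · simp only [hb, h, if_true]; fun_prop
    · simp only [hb, h, if_false]; fun_prop
  have hrc : (r : ℂ) ≠ 0 := by exact_mod_cast hr.ne'
  have hbx : ∀ j, ‖x - p j‖ * max 1 (r / ‖x - p j‖) ≤ ‖b j x‖ := by
    intro j
    by_cases h : ‖p j - x‖ < r
    · simp only [hb, h, if_true, sub_self, mul_zero, sub_zero]
      have : ((r : ℂ) ^ 2 / r) = r := by field_simp
      rw [this, Complex.norm_real, Real.norm_of_nonneg hr.le]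
      rw [norm_sub_rev] at h
      rcases eq_or_ne ‖x - p j‖ 0 with h0 | h0
      · rw [h0]; simp [hr.le]
      · have hpos : 0 < ‖x - p j‖ := lt_of_le_of_ne (norm_nonneg _) h0.symm
        rw [max_eq_right ((one_le_div hpos).2 h.le), mul_div_cancel₀ _ h0]
    · simp only [hb, h, if_false]
      rw [norm_sub_rev] at h
      have hpos : 0 < ‖x - p j‖ := lt_of_lt_of_le hr (not_lt.1 h)
      rw [max_eq_left ((div_le_one hpos).2 (not_lt.1 h)), mul_one]
  have hby : ∀ j y, ‖y - x‖ = r → ‖b j y‖ = ‖y - p j‖ := by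
    intro j y hy
    by_cases h : ‖p j - x‖ < r
    · simp only [hb, h, if_true]
      have h1 : ((r : ℂ) ^ 2) = conj (y - x) * (y - x) := by
        rw [← Complex.normSq_eq_conj_mul_self, Complex.normSq_eq_norm_sq, hy]; push_cast; rfl
      have h2 : (r : ℂ) ^ 2 - conj (p j - x) * (y - x) = conj (y - p j) * (y - x) := by
        rw [h1]; simp only [map_sub]; ring
      rw [h2, norm_div, norm_mul, hy, Complex.norm_conj, Complex.norm_real,
        Real.norm_of_nonneg hr.le, mul_div_assoc, div_self hr.ne', mul_one]
    · simp only [hb, h, if_false]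
  set Q : ℂ → ℂ := fun y => ((∏ j ∈ s, b j y ^ l) * H y) * Complex.exp (-(conj x * (y - x))) with hQ
  have hQd : Differentiable ℂ Q := by
    have h1 : Differentiable ℂ (fun y => ∏ j ∈ s, b j y ^ l) := by
      apply Differentiable.fun_finsetProd
      intro j _
      exact (hbd j).pow l
    apply (h1.mul hH).mul
    fun_prop
  obtain ⟨y, hy, hmax⟩ := Complex.exists_mem_frontier_isMaxOn_norm (U := Metric.ball x r)
    Metric.isBounded_ball ⟨x, Metric.mem_ball_self hr⟩ hQd.diffContOnCl
  rw [frontier_ball _ hr.ne', mem_sphere_iff_norm] at hy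
  have hle : ‖Q x‖ ≤ ‖Q y‖ := hmax (subset_closure (Metric.mem_ball_self hr))
  refine ⟨y, ?_⟩
  have hQx : ‖(∏ j ∈ s, (x - p j) ^ l) * H x‖ * (∏ j ∈ s, max 1 (r / ‖x - p j‖) ^ l) ≤ ‖Q x‖ := by
    simp only [hQ, sub_self, mul_zero, neg_zero, Complex.exp_zero, mul_one, norm_mul, norm_prod,
      norm_pow]
    rw [mul_right_comm, ← Finset.prod_mul_distrib]
    apply mul_le_mul_of_nonneg_right _ (norm_nonneg _)
    apply Finset.prod_le_prod
    · intro j _; positivity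
    · intro j _
      rw [← mul_pow]
      exact pow_le_pow_left₀ (by positivity) (hbx j) l
  have hQy : ‖Q y‖ * Real.exp (-(‖x‖ ^ 2 / 2) - r ^ 2 / 2) =
      ‖(∏ j ∈ s, (y - p j) ^ l) * H y‖ * Real.exp (-(‖y‖ ^ 2 / 2)) := by
    rw [← norm_exp_neg_conj_mul x y, hy]
    simp only [hQ, norm_mul, norm_prod, norm_pow, hby _ y hy]
    ring
  rw [← hQy]
  have hexp : Real.exp (-(‖x‖ ^ 2 / 2) - r ^ 2 / 2) =
      Real.exp (-(‖x‖ ^ 2 / 2)) * Real.exp (-(r ^ 2 / 2)) := by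
    rw [← Real.exp_add]; ring_nf
  calc _ = (‖(∏ j ∈ s, (x - p j) ^ l) * H x‖ * (∏ j ∈ s, max 1 (r / ‖x - p j‖) ^ l)) *
        Real.exp (-(‖x‖ ^ 2 / 2) - r ^ 2 / 2) := by rw [hexp]; ring
    _ ≤ _ := mul_le_mul_of_nonneg_right (hQx.trans hle) (Real.exp_nonneg _)

lemma sq_norm_le_circle_lintegral (g : ℂ → ℂ) (hg : Differentiable ℂ g) (c : ℂ) (r : ℝ) :
    ENNReal.ofReal (2 * Real.pi * ‖g c‖ ^ 2) ≤
      ∫⁻ θ in Set.Ioo (-Real.pi) Real.pi, ENNReal.ofReal (‖g (circleMap c r θ)‖ ^ 2) := by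
  have h1 := DiffContOnCl.circleAverage (f := fun z => g z ^ 2) (c := c) (R := r)
    (hg.pow 2).diffContOnCl
  rw [Real.circleAverage_def] at h1
  have h2 : (∫ θ in (0 : ℝ)..2 * Real.pi, g (circleMap c r θ) ^ 2) =
      ∫ θ in (-Real.pi)..Real.pi, g (circleMap c r θ) ^ 2 := by
    have hper : Function.Periodic (fun θ => g (circleMap c r θ) ^ 2) (2 * Real.pi) := by
      intro θ
      simp only [periodic_circleMap c r θ]
    have := hper.intervalIntegral_add_eq 0 (-Real.pi)
    rw [zero_add] at this
    rw [this]; congr 1; ring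
  have hpi := Real.pi_pos
  have h3 : 2 * Real.pi * ‖g c‖ ^ 2 ≤ ∫ θ in (-Real.pi)..Real.pi, ‖g (circleMap c r θ)‖ ^ 2 := by
    have : ‖g c‖ ^ 2 = (2 * Real.pi)⁻¹ * ‖∫ θ in (-Real.pi)..Real.pi, g (circleMap c r θ) ^ 2‖ := by
      rw [← norm_pow, ← h1, h2, norm_smul, Real.norm_of_nonneg (by positivity)]
    rw [this, ← mul_assoc, mul_inv_cancel₀ (by positivity), one_mul]
    refine (intervalIntegral.norm_integral_le_integral_norm (by linarith)).trans (le_of_eq ?_)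
    simp only [norm_pow]
  refine (ENNReal.ofReal_le_ofReal h3).trans ?_
  have hc2 : Continuous fun θ => ‖g (circleMap c r θ)‖ ^ 2 :=
    (hg.continuous.comp (continuous_circleMap c r)).norm.pow 2
  rw [intervalIntegral.integral_of_le (by linarith),
    integral_Ioc_eq_integral_Ioo,
    ofReal_integral_eq_lintegral_ofReal]
  · exact (hc2.integrableOn_Icc (a := -Real.pi) (b := Real.pi)).mono_set Set.Ioo_subset_Icc_self
  · exact ae_of_all _ fun θ => by positivity

/-- A constant for the Gaussian sub-mean value property. -/
def subMeanConst : ENNReal :=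
  (∫⁻ r in Set.Ioo (0:ℝ) 1, ENNReal.ofReal (r * Real.exp (-r ^ 2) * (2 * Real.pi)))⁻¹

lemma subMeanConst_ne_top : subMeanConst ≠ ⊤ := by
  unfold subMeanConst
  rw [ENNReal.inv_ne_top]
  rw [← pos_iff_ne_zero, setLIntegral_pos_iff (by fun_prop)]
  refine lt_of_lt_of_le ?_ (measure_mono (s := Set.Ioo (0:ℝ) 1) ?_)
  · simp
  · intro r hr
    refine ⟨?_, hr⟩
    have : 0 < r * Real.exp (-r ^ 2) * (2 * Real.pi) :=
      mul_pos (mul_pos hr.1 (Real.exp_pos _)) (by positivity)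
    simpa [Function.mem_support] using this

/-- Sub-mean value property of entire functions with respect to the Gaussian weight. -/
theorem gaussian_subMean (h : ℂ → ℂ) (hh : Differentiable ℂ h) (x : ℂ) :
    ENNReal.ofReal ((‖h x‖ * Real.exp (-(‖x‖ ^ 2 / 2))) ^ 2) ≤
      subMeanConst * ∫⁻ y, ENNReal.ofReal ((‖h y‖ * Real.exp (-(‖y‖ ^ 2 / 2))) ^ 2) := by
  set g : ℂ → ℂ := fun y => h y * Complex.exp (-(conj x * (y - x))) with hg
  have hgd : Differentiable ℂ g := hh.mul (by fun_prop)
  have hgw : ∀ y, (‖h y‖ * Real.exp (-(‖y‖ ^ 2 / 2))) ^ 2 =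
      Real.exp (-‖x‖ ^ 2) * (Real.exp (-‖y - x‖ ^ 2) * ‖g y‖ ^ 2) := by
    intro y
    rw [← norm_exp_neg_conj_mul x y, hg]
    have : Real.exp (-(‖x‖ ^ 2 / 2) - ‖y - x‖ ^ 2 / 2) ^ 2 =
        Real.exp (-‖x‖ ^ 2) * Real.exp (-‖y - x‖ ^ 2) := by
      rw [← Real.exp_nat_mul, ← Real.exp_add]; push_cast; ring_nf
    simp only [norm_mul]
    rw [mul_pow, mul_pow, this]; ring
  have hgx : ‖g x‖ = ‖h x‖ := by simp [hg]
  set K := ∫⁻ r in Set.Ioo (0:ℝ) 1, ENNReal.ofReal (r * Real.exp (-r ^ 2) * (2 * Real.pi)) with hK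
  have hKtop : K ≠ ⊤ := by
    have hc : Continuous fun r : ℝ => r * Real.exp (-r ^ 2) * (2 * Real.pi) := by fun_prop
    have := (hc.integrableOn_Icc (a := 0) (b := 1) (μ := volume)).mono_set Set.Ioo_subset_Icc_self
    exact this.lintegral_lt_top.ne
  have hK0 : K ≠ 0 := by
    have := subMeanConst_ne_top
    rwa [subMeanConst, ENNReal.inv_ne_top] at this
  rw [subMeanConst, ← hK, mul_comm K⁻¹, ← div_eq_mul_inv,
    ENNReal.le_div_iff_mul_le (Or.inl hK0) (Or.inl hKtop)]
  have hmeas : Measurable fun q : ℝ × ℝ => ENNReal.ofReal (Real.exp (-‖x‖ ^ 2)) *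
      (ENNReal.ofReal (q.1 * Real.exp (-q.1 ^ 2)) *
        ENNReal.ofReal (‖g (circleMap x q.1 q.2)‖ ^ 2)) := by
    have : Continuous fun q : ℝ × ℝ => g (circleMap x q.1 q.2) := by
      apply hgd.continuous.comp
      unfold circleMap
      fun_prop
    have h2 : Measurable fun q : ℝ × ℝ => ENNReal.ofReal (‖g (circleMap x q.1 q.2)‖ ^ 2) :=
      ENNReal.measurable_ofReal.comp (this.norm.pow 2).measurable
    exact (Measurable.mul (by fun_prop) h2).const_mul _
  calc ENNReal.ofReal ((‖h x‖ * Real.exp (-(‖x‖ ^ 2 / 2))) ^ 2) * K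
      = ∫⁻ r in Set.Ioo (0:ℝ) 1, ENNReal.ofReal (Real.exp (-‖x‖ ^ 2)) *
          (ENNReal.ofReal (r * Real.exp (-r ^ 2)) * ENNReal.ofReal (2 * Real.pi * ‖g x‖ ^ 2)) := by
        rw [hK, ← lintegral_const_mul _ (by fun_prop)]
        apply setLIntegral_congr_fun measurableSet_Ioo
        intro r hr
        dsimp only
        have hr0 : 0 ≤ r := hr.1.le
        rw [← ENNReal.ofReal_mul (by positivity), ← ENNReal.ofReal_mul (by positivity),
          ← ENNReal.ofReal_mul (by positivity), hgw]
        congr 1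
        simp; ring
    _ ≤ ∫⁻ r in Set.Ioo (0:ℝ) 1, ENNReal.ofReal (Real.exp (-‖x‖ ^ 2)) *
          (ENNReal.ofReal (r * Real.exp (-r ^ 2)) *
          ∫⁻ θ in Set.Ioo (-Real.pi) Real.pi, ENNReal.ofReal (‖g (circleMap x r θ)‖ ^ 2)) := by
        gcongr with r
        exact sq_norm_le_circle_lintegral g hgd x r
    _ ≤ ∫⁻ r in Set.Ioi (0:ℝ), ENNReal.ofReal (Real.exp (-‖x‖ ^ 2)) *
          (ENNReal.ofReal (r * Real.exp (-r ^ 2)) *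
          ∫⁻ θ in Set.Ioo (-Real.pi) Real.pi, ENNReal.ofReal (‖g (circleMap x r θ)‖ ^ 2)) :=
        lintegral_mono_set Set.Ioo_subset_Ioi_self
    _ = ∫⁻ r in Set.Ioi (0:ℝ), ∫⁻ θ in Set.Ioo (-Real.pi) Real.pi,
          ENNReal.ofReal (Real.exp (-‖x‖ ^ 2)) * (ENNReal.ofReal (r * Real.exp (-r ^ 2)) *
            ENNReal.ofReal (‖g (circleMap x r θ)‖ ^ 2)) := by
        congr 1 with r
        have hc : Continuous fun θ => g (circleMap x r θ) :=
          hgd.continuous.comp (continuous_circleMap x r)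
        have h2 : Measurable fun θ => ENNReal.ofReal (‖g (circleMap x r θ)‖ ^ 2) :=
          ENNReal.measurable_ofReal.comp (hc.norm.pow 2).measurable
        rw [lintegral_const_mul _ (h2.const_mul _), lintegral_const_mul _ h2]
    _ = ∫⁻ q in polarCoord.target, ENNReal.ofReal (Real.exp (-‖x‖ ^ 2)) *
          (ENNReal.ofReal (q.1 * Real.exp (-q.1 ^ 2)) *
            ENNReal.ofReal (‖g (circleMap x q.1 q.2)‖ ^ 2)) := by
        rw [polarCoord_target, Measure.volume_eq_prod, setLIntegral_prod _ hmeas.aemeasurable]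
    _ = ∫⁻ y, ENNReal.ofReal ((‖h (x + y)‖ * Real.exp (-(‖x + y‖ ^ 2 / 2))) ^ 2) := by
        rw [← Complex.lintegral_comp_polarCoord_symm]
        apply setLIntegral_congr_fun polarCoord.open_target.measurableSet
        intro q hq
        rw [polarCoord_target] at hq
        have hq0 : 0 < q.1 := hq.1
        have hcm : x + Complex.polarCoord.symm q = circleMap x q.1 q.2 := by
          rw [Complex.polarCoord_symm_apply, circleMap, Complex.exp_mul_I]
          push_cast; rfl
        dsimp only
        rw [hcm, hgw, circleMap_sub_center, norm_circleMap_zero, sq_abs, smul_eq_mul,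
          ← ENNReal.ofReal_mul (by positivity), ← ENNReal.ofReal_mul (by positivity),
          ← ENNReal.ofReal_mul (by positivity)]
        congr 1
        ring
    _ = _ := lintegral_add_left_eq_self
          (fun y => ENNReal.ofReal ((‖h y‖ * Real.exp (-(‖y‖ ^ 2 / 2))) ^ 2)) x

end

section

open ComplexConjugate

/-- A coordinatewise sub-mean value inequality implies a global one. -/
theorem le_pow_mul_lintegral {N : ℕ} (f : (Fin N → ℂ) → ENNReal) (hf : Measurable f) (C : ENNReal)
    (h : ∀ z i, f z ≤ C * ∫⁻ y, f (Function.update z i y)) (z : Fin N → ℂ) :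
    f z ≤ C ^ N * ∫⁻ w, f w := by
  have key : ∀ s : Finset (Fin N), ∀ z, f z ≤
      C ^ s.card * (lmarginal (fun _ => (volume : Measure ℂ)) s f) z := by
    intro s
    induction s using Finset.induction_on with
    | empty => intro z; simp
    | insert i s hi ih =>
      intro z
      refine (ih z).trans ?_
      rw [Finset.card_insert_of_notMem hi, pow_succ, mul_assoc, lmarginal_insert' f hf hi]
      gcongr
      have h1 : f ≤ fun x => C * ∫⁻ y, f (Function.update x i y) := fun x => h x i
      refine (lmarginal_mono h1 z).trans (le_of_eq ?_)
      have hm : Measurable fun x => ∫⁻ y, f (Function.update x i y) := by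
        have := hf.lmarginal (s := {i}) (fun _ => (volume : Measure ℂ))
        rwa [lmarginal_singleton] at this
      exact lintegral_const_mul _ (hm.comp measurable_updateFinset)
  have := key Finset.univ z
  rw [Finset.card_univ, Fintype.card_fin, ← lintegral_eq_lmarginal_univ] at this
  exact this

/-- An inequality between integrals over one coordinate integrates over all coordinates. -/
theorem lintegral_le_of_coordinate {N : ℕ} (f g : (Fin N → ℂ) → ENNReal) (hf : Measurable f)
    (hg : Measurable g) (i : Fin N)
    (h : ∀ z, ∫⁻ y, f (Function.update z i y) ≤ ∫⁻ y, g (Function.update z i y)) :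
    ∫⁻ w, f w ≤ ∫⁻ w, g w := by
  have := lintegral_le_of_lmarginal_le (μ := fun _ : Fin N => (volume : Measure ℂ)) {i} hf hg
    (by intro z; rw [lmarginal_singleton, lmarginal_singleton]; exact h z)
  simpa [volume_pi] using this

lemma integrable_norm_pow_mul_gaussian (k : ℕ) :
    Integrable fun z : ℂ => ‖z‖ ^ k * Real.exp (-‖z‖ ^ 2) := by
  have h := Complex.integral_rpow_mul_exp_neg_rpow (p := 2) (q := k) (by norm_num)
    (by have : (0:ℝ) ≤ k := by positivity
        linarith)
  by_contra hn
  have h0 := integral_undef hn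
  have : (fun z : ℂ => ‖z‖ ^ k * Real.exp (-‖z‖ ^ 2)) =
      fun z : ℂ => ‖z‖ ^ (k:ℝ) * Real.exp (-‖z‖ ^ (2:ℝ)) := by
    ext z; norm_cast
  rw [this, h] at h0
  have : 0 < Real.Gamma (((k:ℝ) + 2) / 2) := Real.Gamma_pos_of_pos (by positivity)
  have := Real.pi_pos
  have : 0 < 2 * Real.pi / 2 * Real.Gamma (((k:ℝ) + 2) / 2) := by positivity
  linarith

lemma integral_norm_sq_pow_mul_gaussian (k : ℕ) :
    ∫ z : ℂ, ‖z‖ ^ (2 * k) * Real.exp (-‖z‖ ^ 2) = Real.pi * (k.factorial : ℝ) := by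
  have h := Complex.integral_rpow_mul_exp_neg_rpow (p := 2) (q := ((2 * k : ℕ) : ℝ)) (by norm_num)
    (by have : (0:ℝ) ≤ ((2 * k : ℕ) : ℝ) := by positivity
        linarith)
  have e : (fun z : ℂ => ‖z‖ ^ (2 * k) * Real.exp (-‖z‖ ^ 2)) =
      fun z : ℂ => ‖z‖ ^ ((2 * k : ℕ) : ℝ) * Real.exp (-‖z‖ ^ (2:ℝ)) := by
    ext z; norm_cast
  rw [e, h]
  have : (((2 * k : ℕ) : ℝ) + 2) / 2 = k + 1 := by push_cast; ring
  rw [this, Real.Gamma_nat_eq_factorial]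
  ring

lemma integrable_monomials_gaussian (k l : ℕ) :
    Integrable fun z : ℂ => z ^ k * conj z ^ l * (Real.exp (-‖z‖ ^ 2) : ℂ) := by
  refine (integrable_norm_pow_mul_gaussian (k + l)).mono' ?_ (ae_of_all _ fun z => ?_)
  · exact (by fun_prop : Continuous fun z : ℂ =>
      z ^ k * conj z ^ l * (Real.exp (-‖z‖ ^ 2) : ℂ)).aestronglyMeasurable
  · rw [norm_mul, norm_mul, norm_pow, norm_pow, Complex.norm_conj, ← pow_add, Complex.norm_real,
      Real.norm_of_nonneg (Real.exp_nonneg _)]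

lemma integral_monomials_gaussian (k l : ℕ) :
    ∫ z : ℂ, z ^ k * conj z ^ l * (Real.exp (-‖z‖ ^ 2) : ℂ) =
      if k = l then ((Real.pi * (k.factorial : ℝ) : ℝ) : ℂ) else 0 := by
  split_ifs with h
  · subst h
    rw [← integral_norm_sq_pow_mul_gaussian, ← integral_complex_ofReal]
    congr 1 with z
    rw [← mul_pow, Complex.mul_conj, Complex.normSq_eq_norm_sq]
    push_cast; ring
  · set α : ℝ := Real.pi / ((k : ℝ) - l) with hα
    have hkl : ((k : ℝ) - l) ≠ 0 := sub_ne_zero.2 (by exact_mod_cast h)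
    have hmp := (rotation (Circle.exp α)).measurePreserving
    have h1 := hmp.integral_comp (rotation (Circle.exp α)).toHomeomorph.measurableEmbedding
      (fun z : ℂ => z ^ k * conj z ^ l * (Real.exp (-‖z‖ ^ 2) : ℂ))
    have h2 : ∀ z : ℂ, (rotation (Circle.exp α) z) ^ k * conj (rotation (Circle.exp α) z) ^ l *
        (Real.exp (-‖rotation (Circle.exp α) z‖ ^ 2) : ℂ) =
        (-1) * (z ^ k * conj z ^ l * (Real.exp (-‖z‖ ^ 2) : ℂ)) := by
      intro z
      rw [LinearIsometryEquiv.norm_map, rotation_apply, Circle.coe_exp]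
      have h3 : Complex.exp (α * Complex.I) ^ k * conj (Complex.exp (α * Complex.I)) ^ l = -1 := by
        rw [← Complex.exp_conj, ← Complex.exp_nat_mul, ← Complex.exp_nat_mul, ← Complex.exp_add,
          ← Complex.exp_pi_mul_I]
        congr 1
        simp only [map_mul, Complex.conj_ofReal, Complex.conj_I]
        have : (α : ℂ) * ((k : ℂ) - l) = Real.pi := by
          rw [hα]; push_cast
          have : (k : ℂ) - l ≠ 0 := by exact_mod_cast hkl
          field_simp
        linear_combination Complex.I * this
      rw [map_mul, mul_pow, mul_pow, ← h3]
      ring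
    simp only [h2] at h1
    rw [integral_const_mul] at h1
    linear_combination (-1/2 : ℂ) * h1

/-- Monomials are orthogonal with respect to the Gaussian weight. -/
theorem integral_polynomial_gaussian (p : Polynomial ℂ) {n : ℕ} (hp : p.natDegree < n) :
    Integrable (fun z : ℂ => ‖p.eval z‖ ^ 2 * Real.exp (-‖z‖ ^ 2)) ∧
    ∫ z : ℂ, ‖p.eval z‖ ^ 2 * Real.exp (-‖z‖ ^ 2) =
      ∑ k ∈ Finset.range n, ‖p.coeff k‖ ^ 2 * (Real.pi * k.factorial) := by
  have e : ∀ z : ℂ, ((‖p.eval z‖ ^ 2 * Real.exp (-‖z‖ ^ 2) : ℝ) : ℂ) =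
      ∑ k ∈ Finset.range n, ∑ l ∈ Finset.range n, (p.coeff k * conj (p.coeff l)) *
        (z ^ k * conj z ^ l * (Real.exp (-‖z‖ ^ 2) : ℂ)) := by
    intro z
    have : ((‖p.eval z‖ ^ 2 : ℝ) : ℂ) = p.eval z * conj (p.eval z) := by
      rw [Complex.mul_conj, Complex.normSq_eq_norm_sq]
    rw [Complex.ofReal_mul, this, Polynomial.eval_eq_sum_range' hp, map_sum, Finset.sum_mul_sum,
      Finset.sum_mul]
    refine Finset.sum_congr rfl fun k _ => ?_
    rw [Finset.sum_mul]
    refine Finset.sum_congr rfl fun l _ => ?_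
    simp only [map_mul, map_pow]
    ring
  have hi : ∀ k l, Integrable fun z : ℂ => (p.coeff k * conj (p.coeff l)) *
        (z ^ k * conj z ^ l * (Real.exp (-‖z‖ ^ 2) : ℂ)) := fun k l =>
    (integrable_monomials_gaussian k l).const_mul _
  have hI : Integrable fun z : ℂ => ((‖p.eval z‖ ^ 2 * Real.exp (-‖z‖ ^ 2) : ℝ) : ℂ) := by
    simp only [e]
    exact integrable_finsetSum _ fun k _ => integrable_finsetSum _ fun l _ => hi k l
  refine ⟨hI.re, ?_⟩
  apply Complex.ofReal_injective
  rw [← integral_complex_ofReal]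
  simp only [e]
  rw [integral_finsetSum _ fun k _ => integrable_finsetSum _ fun l _ => hi k l]
  rw [Complex.ofReal_sum]
  refine Finset.sum_congr rfl fun k hk => ?_
  rw [integral_finsetSum _ fun l _ => hi k l]
  simp only [integral_const_mul, integral_monomials_gaussian]
  simp only [mul_ite, mul_zero, Finset.sum_ite_eq, hk, if_true]
  rw [Complex.mul_conj, Complex.normSq_eq_norm_sq]
  push_cast; rfl

/-- Second moment bound for a polynomial in the lowest Landau level. -/
theorem lintegral_polynomial_second_moment (p : Polynomial ℂ) {d : ℕ} (hp : p.natDegree ≤ d) :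
    ∫⁻ z : ℂ, ENNReal.ofReal (‖z‖ ^ 2 * (‖p.eval z‖ * Real.exp (-(‖z‖ ^ 2 / 2))) ^ 2) ≤
      ENNReal.ofReal (d + 1) *
        ∫⁻ z : ℂ, ENNReal.ofReal ((‖p.eval z‖ * Real.exp (-(‖z‖ ^ 2 / 2))) ^ 2) := by
  have hsq : ∀ z : ℂ, Real.exp (-(‖z‖ ^ 2 / 2)) ^ 2 = Real.exp (-‖z‖ ^ 2) := by
    intro z; rw [← Real.exp_nat_mul]; push_cast; ring_nf
  simp only [mul_pow, hsq]
  obtain ⟨h1, h2⟩ := integral_polynomial_gaussian p (n := d + 1) (by omega)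
  have hX : (Polynomial.X * p).natDegree < d + 2 :=
    lt_of_le_of_lt Polynomial.natDegree_mul_le (by
      have := Polynomial.natDegree_X_le (R := ℂ); omega)
  obtain ⟨h3, h4⟩ := integral_polynomial_gaussian (Polynomial.X * p) hX
  have e : ∀ z : ℂ, ‖z‖ ^ 2 * (‖p.eval z‖ ^ 2 * Real.exp (-‖z‖ ^ 2)) =
      ‖(Polynomial.X * p).eval z‖ ^ 2 * Real.exp (-‖z‖ ^ 2) := by
    intro z; simp only [Polynomial.eval_mul, Polynomial.eval_X, norm_mul]; ring
  simp only [e]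
  rw [← ofReal_integral_eq_lintegral_ofReal h3 (ae_of_all _ fun z => by positivity),
    ← ofReal_integral_eq_lintegral_ofReal h1 (ae_of_all _ fun z => by positivity),
    ← ENNReal.ofReal_mul (by positivity)]
  apply ENNReal.ofReal_le_ofReal
  rw [h2, h4, Finset.sum_range_succ']
  simp only [Polynomial.coeff_X_mul, Polynomial.coeff_X_mul_zero, norm_zero]
  rw [Finset.mul_sum]
  simp only [ne_eq, OfNat.ofNat_ne_zero, not_false_eq_true, zero_pow, zero_mul, add_zero]
  refine Finset.sum_le_sum fun k hk => ?_
  have hk' : (k : ℝ) ≤ d := by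
    have := Finset.mem_range.1 hk
    exact_mod_cast Nat.lt_succ_iff.1 this
  rw [Nat.factorial_succ]
  push_cast
  have : 0 ≤ ‖p.coeff k‖ ^ 2 * (Real.pi * k.factorial) := by
    have := Real.pi_pos
    positivity
  nlinarith

end

/-- A near-maximizer of a plasma weight contains a large subconfiguration which satisfies the
exclusion rule on every scale. -/
theorem exists_exclusion_subset {N : ℕ} (l : ℕ) (w : (Fin N → ℂ) → ℝ) (S : ℝ)
    (hS : ∀ z, w z ≤ S)
    (hgain : ∀ z i r, 0 < r → ∃ y, w z * (∏ j ∈ Finset.univ.erase i,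
      max 1 (r / ‖z i - z j‖) ^ l) * Real.exp (-(r ^ 2 / 2)) ≤ w (Function.update z i y))
    (z : Fin N → ℂ) (hz : 0 < w z) (M g : ℝ) (hg : 0 < g) (hM : S < Real.exp M * w z) :
    ∃ I : Finset (Fin N), ((N : ℝ) - I.card) * g ≤ M ∧ ∀ i ∈ I, ∀ r, 0 < r →
      ∑ j ∈ I.erase i, (l : ℝ) * Real.log (max 1 (r / ‖z i - z j‖)) ≤ r ^ 2 / 2 + g := by
  classical
  set Q : ℕ → Prop := fun n => ∃ (z' : Fin N → ℂ) (T : Finset (Fin N)), T.card ≤ n ∧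
    (∀ j, j ∉ T → z' j = z j) ∧ Real.exp (g * n) * w z ≤ w z' with hQ
  have hQ0 : Q 0 := ⟨z, ∅, by simp, by simp, by simp⟩
  have hQb : ∀ n, Q n → g * n < M := by
    rintro n ⟨z', T, -, -, h⟩
    have := (h.trans (hS z')).trans_lt hM
    exact Real.exp_lt_exp.1 (lt_of_mul_lt_mul_right this hz.le)
  obtain ⟨n, hn, hn1⟩ : ∃ n, Q n ∧ ¬ Q (n + 1) := by
    by_contra hcon
    push Not at hcon
    have hall : ∀ n, Q n := fun n => Nat.rec hQ0 (fun n hn => hcon n hn) n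
    obtain ⟨n, hn⟩ := exists_nat_gt (M / g)
    have := hQb n (hall n)
    rw [div_lt_iff₀ hg] at hn
    linarith
  have hnM := hQb n hn
  obtain ⟨z', T, hT, hz', hw⟩ := hn
  have hw' : 0 < w z' := lt_of_lt_of_le (by positivity) hw
  refine ⟨Tᶜ, ?_, ?_⟩
  · have : (N : ℝ) - (Tᶜ.card : ℝ) = T.card := by
      have h := Finset.card_add_card_compl T
      rw [Fintype.card_fin] at h
      have : ((T.card + Tᶜ.card : ℕ) : ℝ) = N := by rw [h]
      push_cast at this; linarith
    rw [this]
    have : (T.card : ℝ) ≤ n := by exact_mod_cast hT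
    nlinarith
  · intro i hi r hr
    obtain ⟨y, hy⟩ := hgain z' i r hr
    have hlt : w (Function.update z' i y) < Real.exp g * w z' := by
      by_contra hcon
      push Not at hcon
      apply hn1
      refine ⟨Function.update z' i y, insert i T, (Finset.card_insert_le _ _).trans (by omega),
        ?_, ?_⟩
      · intro j hj
        rw [Finset.mem_insert, not_or] at hj
        rw [Function.update_of_ne hj.1]
        exact hz' j hj.2
      · refine le_trans ?_ hcon
        have : Real.exp (g * (n + 1 : ℕ)) = Real.exp g * Real.exp (g * n) := by
          rw [← Real.exp_add]; push_cast; ring_nf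
        rw [this, mul_assoc]
        gcongr
    have hprod : (∏ j ∈ Finset.univ.erase i, max 1 (r / ‖z' i - z' j‖) ^ l) ≤
        Real.exp (r ^ 2 / 2 + g) := by
      have h1 := hy.trans hlt.le
      rw [Real.exp_neg, ← div_eq_mul_inv, div_le_iff₀ (Real.exp_pos _)] at h1
      rw [Real.exp_add]
      refine le_of_mul_le_mul_left (h1.trans (le_of_eq ?_)) hw'
      ring
    have hpos : ∀ j, 0 < max 1 (r / ‖z' i - z' j‖) ^ l := fun j => by positivity
    have hlog := Real.log_le_log (Finset.prod_pos fun j _ => hpos j) hprod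
    rw [Real.log_exp, Real.log_prod fun j _ => (hpos j).ne'] at hlog
    refine le_trans ?_ hlog
    have hsub : Tᶜ.erase i ⊆ Finset.univ.erase i :=
      Finset.erase_subset_erase _ (Finset.subset_univ _)
    refine le_trans (le_of_eq ?_) (Finset.sum_le_sum_of_subset_of_nonneg hsub ?_)
    · refine Finset.sum_congr rfl fun j hj => ?_
      rw [Real.log_pow, hz' i (Finset.mem_compl.1 hi),
        hz' j (Finset.mem_compl.1 (Finset.mem_of_mem_erase hj))]
    · intro j _ _
      exact Real.log_nonneg (one_le_pow₀ (le_max_left _ _))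

lemma potential_ge_of_ball_ge (μ : Measure ℂ) (x : ℂ) (β s δ : ℝ) (hβ : 0 ≤ β) (hδ : 0 < δ)
    (hs : δ < s)
    (hball : ∀ u, 0 < u → u ≤ s → ENNReal.ofReal (β * u ^ 2) ≤ μ (Metric.closedBall x u)) :
    ENNReal.ofReal (β * (s ^ 2 / 2 - δ ^ 2 / 2 - 2 * δ * s)) ≤
      ∫⁻ y, ENNReal.ofReal (Real.log (max 1 (s / (‖y - x‖ + δ)))) ∂μ := by
  have hs0 : 0 < s := hδ.trans hs
  have hcont : Continuous fun y : ℂ => Real.log (max 1 (s / (‖y - x‖ + δ))) := by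
    refine Continuous.log (continuous_const.max (continuous_const.div (by fun_prop) ?_)) ?_
    · intro y; positivity
    · intro y; positivity
  rw [lintegral_eq_lintegral_meas_le μ (ae_of_all _ fun y => Real.log_nonneg (le_max_left _ _))
    hcont.aemeasurable]
  set L := Real.log (s / δ) with hL
  have hL0 : 0 < L := Real.log_pos ((one_lt_div hδ).2 hs)
  have heL : Real.exp (-L) = δ / s := by
    rw [hL, Real.exp_neg, Real.exp_log (by positivity), inv_div]
  have step : ∀ t ∈ Set.Ioo 0 L, ENNReal.ofReal (β * (s * Real.exp (-t) - δ) ^ 2) ≤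
      μ {y | t ≤ Real.log (max 1 (s / (‖y - x‖ + δ)))} := by
    intro t ht
    have h1 : δ < s * Real.exp (-t) := by
      have : Real.exp (-L) < Real.exp (-t) := Real.exp_lt_exp.2 (by linarith [ht.2])
      rw [heL, div_lt_iff₀ hs0] at this
      linarith
    have h2 : Real.exp (-t) ≤ 1 := Real.exp_le_one_iff.2 (by linarith [ht.1])
    refine (hball _ (sub_pos.2 h1) ?_).trans (measure_mono ?_)
    · nlinarith
    · intro y hy
      rw [Metric.mem_closedBall, dist_eq_norm] at hy
      have hpos : 0 < ‖y - x‖ + δ := by positivity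
      rw [Set.mem_ofPred_eq, Real.le_log_iff_exp_le (by positivity)]
      refine le_trans ?_ (le_max_right _ _)
      rw [le_div_iff₀ hpos]
      have : Real.exp t * Real.exp (-t) = 1 := by rw [← Real.exp_add]; simp
      calc Real.exp t * (‖y - x‖ + δ) ≤ Real.exp t * (s * Real.exp (-t)) := by
            gcongr; linarith
        _ = s * (Real.exp t * Real.exp (-t)) := by ring
        _ = s := by rw [this, mul_one]
  have hint : ∫ t in (0:ℝ)..L, β * (s * Real.exp (-t) - δ) ^ 2 =
      β * (s ^ 2 / 2 * (1 - (δ / s) ^ 2) - 2 * δ * s * (1 - δ / s) + δ ^ 2 * L) := by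
    have hd : ∀ t ∈ Set.uIcc 0 L, HasDerivAt (fun t => β * (-(s ^ 2 / 2) * Real.exp (-t) ^ 2 +
        2 * δ * s * Real.exp (-t) + δ ^ 2 * t)) (β * (s * Real.exp (-t) - δ) ^ 2) t := by
      intro t _
      have he : HasDerivAt (fun t : ℝ => Real.exp (-t)) (-Real.exp (-t)) t := by
        simpa using (hasDerivAt_neg t).exp
      refine HasDerivAt.congr_deriv (((((he.pow 2).const_mul (-(s ^ 2 / 2))).add (he.const_mul (2 * δ * s))).add
        ((hasDerivAt_id t).const_mul (δ ^ 2))).const_mul β) ?_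
      push_cast
      ring
    rw [intervalIntegral.integral_eq_sub_of_hasDerivAt hd
      (by apply Continuous.intervalIntegrable; fun_prop), heL]
    simp
    ring
  have hle : β * (s ^ 2 / 2 - δ ^ 2 / 2 - 2 * δ * s) ≤
      ∫ t in (0:ℝ)..L, β * (s * Real.exp (-t) - δ) ^ 2 := by
    rw [hint]
    apply mul_le_mul_of_nonneg_left _ hβ
    have e1 : s ^ 2 / 2 * (1 - (δ / s) ^ 2) = s ^ 2 / 2 - δ ^ 2 / 2 := by field_simp
    have e2 : 2 * δ * s * (1 - δ / s) = 2 * δ * s - 2 * δ ^ 2 := by field_simp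
    rw [e1, e2]
    have : 0 ≤ δ ^ 2 * L := by positivity
    nlinarith [sq_nonneg δ]
  refine (ENNReal.ofReal_le_ofReal hle).trans ?_
  rw [intervalIntegral.integral_of_le hL0.le, integral_Ioc_eq_integral_Ioo,
    ofReal_integral_eq_lintegral_ofReal]
  · refine (setLIntegral_mono' measurableSet_Ioo step).trans ?_
    exact lintegral_mono_set Set.Ioo_subset_Ioi_self
  · have hc : Continuous fun t : ℝ => β * (s * Real.exp (-t) - δ) ^ 2 := by fun_prop
    exact (hc.integrableOn_Icc (a := 0) (b := L) (μ := volume)).mono_set Set.Ioo_subset_Icc_self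
  · exact ae_of_all _ fun t => by positivity

/-- A probability measure that satisfies the exclusion rule on all scales around all points of its
support has density at most `1 / (π l)`. -/
theorem measure_le_of_exclusion (μ : Measure ℂ) [IsProbabilityMeasure μ] (l : ℝ) (hl : 0 < l)
    (h : ∀ x ∈ μ.support, ∀ s, 0 < s → ∀ δ, 0 < δ →
      ∫⁻ y, ENNReal.ofReal (Real.log (max 1 (s / (‖y - x‖ + δ)))) ∂μ ≤
        ENNReal.ofReal (s ^ 2 / (2 * l))) :
    μ ≤ ENNReal.ofReal (1 / (Real.pi * l)) • volume := by
  have hpi := Real.pi_pos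
  have hae : ∀ᵐ x ∂μ, ENNReal.ofReal (Real.pi * l) ≤ (volume : Measure ℂ).rnDeriv μ x := by
    filter_upwards [Besicovitch.ae_tendsto_rnDeriv (volume : Measure ℂ) μ,
      Measure.support_mem_ae (μ := μ)] with x hx hsupp
    by_contra hcon
    push Not at hcon
    obtain ⟨θ, hθ1, hθ2⟩ := ENNReal.lt_iff_exists_nnreal_btwn.1 hcon
    have hθ2' : (θ : ℝ) < Real.pi * l := by
      rw [ENNReal.lt_ofReal_iff_toReal_lt ENNReal.coe_ne_top] at hθ2
      simpa using hθ2
    have hθ0 : 0 < (θ : ℝ) := by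
      have : (0 : ENNReal) < θ := lt_of_le_of_lt zero_le hθ1
      exact_mod_cast this
    have hev := hx.eventually (Iio_mem_nhds hθ1)
    rw [eventually_iff, mem_nhdsGT_iff_exists_Ioc_subset] at hev
    obtain ⟨s, hs, hsub⟩ := hev
    have hs : 0 < s := hs
    have hball : ∀ u, 0 < u → u ≤ s →
        ENNReal.ofReal (Real.pi / θ * u ^ 2) ≤ μ (Metric.closedBall x u) := by
      intro u hu0 hus
      have h1 : volume (Metric.closedBall x u) / μ (Metric.closedBall x u) < θ := hsub ⟨hu0, hus⟩
      have hv : volume (Metric.closedBall x u) = ENNReal.ofReal (Real.pi * u ^ 2) := by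
        rw [Complex.volume_closedBall, ENNReal.ofReal_mul hpi.le, ENNReal.ofReal_pow hu0.le,
          mul_comm]
        congr 1
        rw [← NNReal.coe_real_pi, ENNReal.ofReal_coe_nnreal]
      rw [hv] at h1
      have h2 : ENNReal.ofReal (Real.pi * u ^ 2) ≤ θ * μ (Metric.closedBall x u) :=
        (ENNReal.div_le_iff_le_mul (Or.inr ENNReal.coe_ne_top)
          (Or.inl (measure_ne_top _ _))).1 h1.le
      have h3 : Real.pi / θ * u ^ 2 = (Real.pi * u ^ 2) / θ := by ring
      rw [h3, ENNReal.ofReal_div_of_pos hθ0, ENNReal.ofReal_coe_nnreal]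
      exact ENNReal.div_le_of_le_mul' h2
    have key : ∀ δ, 0 < δ → δ < s →
        Real.pi / θ * (s ^ 2 / 2 - δ ^ 2 / 2 - 2 * δ * s) ≤ s ^ 2 / (2 * l) := by
      intro δ hδ hδs
      have h1 := (potential_ge_of_ball_ge μ x (Real.pi / θ) s δ (by positivity) hδ hδs hball).trans
        (h x hsupp s hs δ hδ)
      exact (ENNReal.ofReal_le_ofReal_iff (by positivity)).1 h1
    have hlim : Tendsto (fun δ : ℝ => Real.pi / θ * (s ^ 2 / 2 - δ ^ 2 / 2 - 2 * δ * s)) (𝓝[>] 0)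
        (𝓝 (Real.pi / θ * (s ^ 2 / 2 - 0 ^ 2 / 2 - 2 * 0 * s))) := by
      apply tendsto_nhdsWithin_of_tendsto_nhds
      apply Continuous.tendsto
      fun_prop
    have h2 := le_of_tendsto hlim (by
      filter_upwards [Ioo_mem_nhdsGT hs] with δ hδ using key δ hδ.1 hδ.2)
    have h3 : Real.pi / θ * (s ^ 2 / 2 - 0 ^ 2 / 2 - 2 * 0 * s) = Real.pi * s ^ 2 / (2 * θ) := by
      field_simp; ring
    rw [h3, div_le_div_iff₀ (by positivity) (by positivity)] at h2
    have : 0 < s ^ 2 := by positivity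
    nlinarith
  refine Measure.le_iff.2 fun E hE => ?_
  have h1 : ENNReal.ofReal (Real.pi * l) * μ E ≤ volume E := by
    calc ENNReal.ofReal (Real.pi * l) * μ E = ∫⁻ _ in E, ENNReal.ofReal (Real.pi * l) ∂μ := by
          rw [setLIntegral_const]
      _ ≤ ∫⁻ x in E, (volume : Measure ℂ).rnDeriv μ x ∂μ :=
          lintegral_mono_ae (ae_restrict_of_ae hae)
      _ ≤ volume E := Measure.setLIntegral_rnDeriv_le E
  have h2 : (ENNReal.ofReal (1 / (Real.pi * l)) • (volume : Measure ℂ)) E =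
      volume E / ENNReal.ofReal (Real.pi * l) := by
    rw [Measure.smul_apply, smul_eq_mul, one_div, ENNReal.ofReal_inv_of_pos (by positivity),
      div_eq_mul_inv, mul_comm]
  rw [h2]
  rw [ENNReal.le_div_iff_mul_le (Or.inl (by simp; positivity)) (Or.inl ENNReal.ofReal_ne_top),
    mul_comm]
  exact h1

/-- The empirical measure of a configuration of points. -/
def empiricalMeasure {N : ℕ} (x : Fin N → ℂ) : Measure ℂ :=
  (N : ENNReal)⁻¹ • ∑ j, Measure.dirac (x j)

lemma isProbabilityMeasure_empiricalMeasure {N : ℕ} (hN : 0 < N) (x : Fin N → ℂ) :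
    IsProbabilityMeasure (empiricalMeasure x) := by
  constructor
  have h0 : (N : ENNReal) ≠ 0 := by exact_mod_cast hN.ne'
  simp [empiricalMeasure, ENNReal.inv_mul_cancel h0 (ENNReal.natCast_ne_top N)]

lemma integral_empiricalMeasure {N : ℕ} (x : Fin N → ℂ) (f : ℂ → ℝ) :
    ∫ y, f y ∂(empiricalMeasure x) = (∑ j, f (x j)) / N := by
  rw [empiricalMeasure, integral_smul_measure, integral_finsetSum_measure]
  · simp [integral_dirac, div_eq_inv_mul]
  · intro i _
    exact integrable_dirac (by simp)

lemma lintegral_empiricalMeasure {N : ℕ} (x : Fin N → ℂ) (f : ℂ → ENNReal) :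
    ∫⁻ y, f y ∂(empiricalMeasure x) = (N : ENNReal)⁻¹ * ∑ j, f (x j) := by
  rw [empiricalMeasure, lintegral_smul_measure, lintegral_finsetSum_measure]
  simp [lintegral_dirac]

lemma tendsto_integral_of_bounded {κ : Type*} {u : Filter κ} {P : κ → ProbabilityMeasure ℂ}
    {μ : ProbabilityMeasure ℂ} (h : Tendsto P u (𝓝 μ)) (f : ℂ → ℝ) (hf : Continuous f) (C : ℝ)
    (h0 : ∀ x, 0 ≤ f x) (hC : ∀ x, f x ≤ C) :
    Tendsto (fun k => ∫ x, f x ∂(P k : Measure ℂ)) u (𝓝 (∫ x, f x ∂(μ : Measure ℂ))) :=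
  ProbabilityMeasure.tendsto_iff_forall_integral_tendsto.1 h
    (BoundedContinuousFunction.ofNormedAddCommGroup f hf C fun x => by
      rw [Real.norm_of_nonneg (h0 x)]; exact hC x)

lemma isTight_empiricalMeasure (U : ℂ → ℝ) (hU : Continuous U) (hUinf : Tendsto U (cocompact ℂ) atTop)
    (b : ℝ) {κ : Type*} (N : κ → ℕ) (hN : ∀ k, 0 < N k) (x : ∀ k, Fin (N k) → ℂ)
    (hU0 : ∀ y, 0 ≤ U y) (hx : ∀ k, ∑ j, U (x k j) ≤ N k * b) :
    IsTightMeasureSet (Set.range fun k => empiricalMeasure (x k)) := by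
  rw [isTightMeasureSet_iff_exists_isCompact_measure_compl_le]
  intro ε hε
  rcases eq_or_ne ε ⊤ with rfl | hεt
  · exact ⟨∅, isCompact_empty, fun _ _ => le_top⟩
  have hε' : 0 < ε.toReal := ENNReal.toReal_pos hε.ne' hεt
  set M := max 1 (b / ε.toReal) with hM
  have hM0 : 0 < M := lt_of_lt_of_le one_pos (le_max_left _ _)
  obtain ⟨K, hK, hKU⟩ := mem_cocompact.1 (hUinf.eventually_ge_atTop M)
  refine ⟨K, hK, ?_⟩
  rintro _ ⟨k, rfl⟩
  have h1 : ∫⁻ y, ENNReal.ofReal (U y) ∂(empiricalMeasure (x k)) ≤ ENNReal.ofReal b := by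
    rw [lintegral_empiricalMeasure, ← ENNReal.ofReal_sum_of_nonneg (fun i _ => hU0 _)]
    have hNk : (0 : ℝ) < N k := by exact_mod_cast hN k
    rw [← ENNReal.ofReal_natCast, ← ENNReal.ofReal_inv_of_pos hNk,
      ← ENNReal.ofReal_mul (by positivity)]
    apply ENNReal.ofReal_le_ofReal
    rw [inv_mul_le_iff₀ hNk]
    exact hx k
  have h2 := mul_meas_ge_le_lintegral (μ := empiricalMeasure (x k))
    (f := fun y => ENNReal.ofReal (U y)) (by fun_prop) (ENNReal.ofReal M)
  have h3 : empiricalMeasure (x k) Kᶜ ≤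
      empiricalMeasure (x k) {y | ENNReal.ofReal M ≤ ENNReal.ofReal (U y)} :=
    measure_mono fun y hy => ENNReal.ofReal_le_ofReal (hKU hy)
  have h4 : ENNReal.ofReal b ≤ ENNReal.ofReal M * ε := by
    rw [← ENNReal.ofReal_toReal hεt, ← ENNReal.ofReal_mul hM0.le]
    apply ENNReal.ofReal_le_ofReal
    rw [← div_le_iff₀ hε']
    exact le_max_right _ _
  have h5 : ENNReal.ofReal M * empiricalMeasure (x k) Kᶜ ≤ ENNReal.ofReal M * ε :=
    (mul_le_mul_right h3 _).trans ((h2.trans h1).trans h4)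
  exact (ENNReal.mul_le_mul_iff_right (by simpa using hM0) ENNReal.ofReal_ne_top).1 h5

lemma sum_kernel_le {N : ℕ} (x : Fin N → ℂ) (hx : Function.Injective x) (I : Finset (Fin N))
    {l ε s δ : ℝ} (hl : 0 < l) (hs : 0 < s) (hδ : 0 < δ) (hI : (N : ℝ) - I.card ≤ ε * N)
    (i : Fin N) (a : ℂ) (hia : ‖x i - a‖ < δ)
    (h : ∑ j ∈ I.erase i, l * Real.log (max 1 (s / ‖x i - x j‖)) ≤ N * (s ^ 2 / 2) + ε * N) :
    ∑ j, Real.log (max 1 (s / (‖x j - a‖ + δ))) ≤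
      N * (s ^ 2 / (2 * l)) + ε * N / l + (ε * N + 1) * Real.log (max 1 (s / δ)) := by
  classical
  set ψ : Fin N → ℝ := fun j => Real.log (max 1 (s / (‖x j - a‖ + δ))) with hψ
  have hψ1 : ∀ j, ψ j ≤ Real.log (max 1 (s / δ)) := by
    intro j
    apply Real.log_le_log (by positivity)
    apply max_le_max le_rfl
    apply div_le_div_of_nonneg_left hs.le hδ
    linarith [norm_nonneg (x j - a)]
  have hψ2 : ∀ j, j ≠ i → ψ j ≤ Real.log (max 1 (s / ‖x i - x j‖)) := by
    intro j hj
    apply Real.log_le_log (by positivity)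
    apply max_le_max le_rfl
    have hpos : 0 < ‖x i - x j‖ := norm_pos_iff.2 (sub_ne_zero.2 fun hc => hj (hx hc).symm)
    apply div_le_div_of_nonneg_left hs.le hpos
    have : x i - x j = (x i - a) - (x j - a) := by ring
    rw [this]
    exact (norm_sub_le _ _).trans (by linarith)
  have hsplit : ∑ j, ψ j = ∑ j ∈ I.erase i, ψ j + ∑ j ∈ (I.erase i)ᶜ, ψ j :=
    (Finset.sum_add_sum_compl _ _).symm
  have h1 : ∑ j ∈ I.erase i, ψ j ≤ N * (s ^ 2 / (2 * l)) + ε * N / l := by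
    have : ∑ j ∈ I.erase i, ψ j ≤ ∑ j ∈ I.erase i, Real.log (max 1 (s / ‖x i - x j‖)) :=
      Finset.sum_le_sum fun j hj => hψ2 j (Finset.ne_of_mem_erase hj)
    rw [← Finset.mul_sum] at h
    have e : N * (s ^ 2 / (2 * l)) + ε * N / l = (N * (s ^ 2 / 2) + ε * N) / l := by
      field_simp
    rw [e, le_div_iff₀ hl, mul_comm]
    exact (mul_le_mul_of_nonneg_left this hl.le).trans h
  have h2 : ∑ j ∈ (I.erase i)ᶜ, ψ j ≤ (ε * N + 1) * Real.log (max 1 (s / δ)) := by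
    refine (Finset.sum_le_card_nsmul _ _ _ fun j _ => hψ1 j).trans ?_
    rw [nsmul_eq_mul]
    apply mul_le_mul_of_nonneg_right _ (Real.log_nonneg (le_max_left _ _))
    have hc : (I.erase i)ᶜ.card ≤ Iᶜ.card + 1 := by
      have h3 := Finset.card_add_card_compl I
      have h4 := Finset.card_add_card_compl (I.erase i)
      have h5 := Finset.pred_card_le_card_erase (s := I) (a := i)
      omega
    have hc' : ((I.erase i)ᶜ.card : ℝ) ≤ Iᶜ.card + 1 := by exact_mod_cast hc
    have h3 := Finset.card_add_card_compl I
    rw [Fintype.card_fin] at h3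
    have h3' : (I.card : ℝ) + Iᶜ.card = N := by exact_mod_cast h3
    linarith
  rw [hsplit]
  linarith

/-- Configurations which satisfy the exclusion rule up to small errors have asymptotically at
least the bath-tub energy. -/
theorem potential_lower_bound_of_exclusion (U : ℂ → ℝ) (hU : Continuous U)
    (hU0 : ∀ y, 0 ≤ U y) (hUinf : Tendsto U (cocompact ℂ) atTop) (l : ℝ) (hl : 0 < l) (b : ℝ)
    (hb : ∀ μ : Measure ℂ, IsProbabilityMeasure μ →
      μ ≤ ENNReal.ofReal (1 / (Real.pi * l)) • volume →
      ENNReal.ofReal b < ∫⁻ x, ENNReal.ofReal (U x) ∂μ) :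
    ∃ ε > 0, ∃ N₀ : ℕ, ∀ N ≥ N₀, ∀ x : Fin N → ℂ, Function.Injective x → ∀ I : Finset (Fin N),
      ((N : ℝ) - I.card ≤ ε * N) →
      (∀ i ∈ I, ∀ s, 0 < s → ∑ j ∈ I.erase i, l * Real.log (max 1 (s / ‖x i - x j‖)) ≤
        N * (s ^ 2 / 2) + ε * N) →
      N * b < ∑ j, U (x j) := by
  by_contra hcon
  push Not at hcon
  have hcon' : ∀ k : ℕ, ∃ N ≥ k + 1, ∃ x : Fin N → ℂ, Function.Injective x ∧
      ∃ I : Finset (Fin N), ((N : ℝ) - I.card ≤ 1 / ((k : ℝ) + 1) * N) ∧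
      (∀ i ∈ I, ∀ s, 0 < s → ∑ j ∈ I.erase i, l * Real.log (max 1 (s / ‖x i - x j‖)) ≤
        N * (s ^ 2 / 2) + 1 / ((k : ℝ) + 1) * N) ∧ ∑ j, U (x j) ≤ N * b :=
    fun k => hcon (1 / ((k : ℝ) + 1)) (by positivity) (k + 1)
  choose N hNk x hx I hI hexc hUx using hcon'
  have hN : ∀ k, 0 < N k := fun k => by have := hNk k; omega
  have hNr : ∀ k, (0 : ℝ) < N k := fun k => by exact_mod_cast hN k
  set P : ℕ → ProbabilityMeasure ℂ := fun k =>
    ⟨empiricalMeasure (x k), isProbabilityMeasure_empiricalMeasure (hN k) (x k)⟩ with hP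
  have hcomp : IsCompact (closure (Set.range P)) := by
    apply isCompact_closure_of_isTightMeasureSet
    refine (isTight_empiricalMeasure U hU hUinf b N hN x hU0 hUx).subset ?_
    intro ν hν
    obtain ⟨ν', hν', rfl⟩ := hν
    obtain ⟨k, rfl⟩ := Set.mem_range.1 hν'
    exact Set.mem_range.2 ⟨k, rfl⟩
  set u : Ultrafilter ℕ := Ultrafilter.of atTop with hu
  have hu_le : (u : Filter ℕ) ≤ atTop := Ultrafilter.of_le _
  obtain ⟨μ, -, hμ⟩ := hcomp.ultrafilter_le_nhds (u.map P) (by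
    rw [le_principal_iff]
    exact Filter.eventually_map.2 (Eventually.of_forall fun k => subset_closure ⟨k, rfl⟩))
  have hμ : Tendsto P u (𝓝 μ) := hμ
  have hεlim : Tendsto (fun k : ℕ => 1 / ((k : ℝ) + 1)) u (𝓝 0) :=
    tendsto_one_div_add_atTop_nhds_zero_nat.mono_left hu_le
  have hNlim : Tendsto (fun k : ℕ => 1 / (N k : ℝ)) u (𝓝 0) := by
    refine tendsto_of_tendsto_of_tendsto_of_le_of_le tendsto_const_nhds hεlim
      (fun k => by positivity) fun k => ?_
    apply one_div_le_one_div_of_le (by positivity)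
    exact_mod_cast hNk k
  have hexcl : (μ : Measure ℂ) ≤ ENNReal.ofReal (1 / (Real.pi * l)) • volume := by
    refine measure_le_of_exclusion μ l hl fun a ha s hs δ hδ => ?_
    set tent : ℂ → ℝ := fun y => max 0 (1 - ‖y - a‖ / δ) with htent
    have htc : Continuous tent := by fun_prop
    have ht0 : ∀ y, 0 ≤ tent y := fun y => le_max_left _ _
    have ht1 : ∀ y, tent y ≤ 1 := fun y => by
      apply max_le zero_le_one
      have : 0 ≤ ‖y - a‖ / δ := by positivity
      linarith
    have htlim := tendsto_integral_of_bounded hμ tent htc 1 ht0 ht1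
    have htpos : 0 < ∫ y, tent y ∂(μ : Measure ℂ) := by
      rw [integral_pos_iff_support_of_nonneg ht0]
      · refine lt_of_lt_of_le ((Measure.mem_support_iff_forall a).1 ha _ (Metric.ball_mem_nhds a hδ))
          (measure_mono ?_)
        intro y hy
        rw [Metric.mem_ball, dist_eq_norm] at hy
        have : 0 < 1 - ‖y - a‖ / δ := by
          rw [sub_pos, div_lt_one hδ]; exact hy
        exact ne_of_gt (lt_of_lt_of_le this (le_max_right _ _))
      · refine Integrable.of_bound htc.aestronglyMeasurable 1 (ae_of_all _ fun y => ?_)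
        rw [Real.norm_of_nonneg (ht0 y)]; exact ht1 y
    have hnear : ∀ᶠ k in (u : Filter ℕ), ∃ i ∈ I k, ‖x k i - a‖ < δ := by
      have h1 := htlim.eventually_const_lt (half_lt_self htpos)
      have h2 := hεlim.eventually_lt_const (half_pos htpos)
      filter_upwards [h1, h2] with k hk1 hk2
      by_contra hno
      push Not at hno
      have hk1' : (∫ y, tent y ∂(μ : Measure ℂ)) / 2 < (∑ j, tent (x k j)) / N k := by
        rw [← integral_empiricalMeasure]; exact hk1
      have h3 : ∑ j, tent (x k j) ≤ (I k)ᶜ.card := by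
        rw [← Finset.sum_add_sum_compl (I k)]
        have : ∑ j ∈ I k, tent (x k j) = 0 := by
          refine Finset.sum_eq_zero fun j hj => ?_
          have := (one_le_div hδ).2 (hno j hj)
          exact max_eq_left (by linarith)
        rw [this, zero_add]
        refine (Finset.sum_le_card_nsmul _ _ 1 fun j _ => ht1 _).trans (by simp)
      have h4 := Finset.card_add_card_compl (I k)
      rw [Fintype.card_fin] at h4
      have h4' : ((I k).card : ℝ) + (I k)ᶜ.card = N k := by exact_mod_cast h4
      rw [lt_div_iff₀ (hNr k)] at hk1'
      have := hI k
      have := mul_lt_mul_of_pos_right hk2 (hNr k)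
      linarith
    set ψ : ℂ → ℝ := fun y => Real.log (max 1 (s / (‖y - a‖ + δ))) with hψ
    have hψc : Continuous ψ := by
      refine Continuous.log (continuous_const.max (continuous_const.div (by fun_prop) ?_)) ?_
      · intro y; positivity
      · intro y; positivity
    have hψ0 : ∀ y, 0 ≤ ψ y := fun y => Real.log_nonneg (le_max_left _ _)
    have hψ1 : ∀ y, ψ y ≤ Real.log (max 1 (s / δ)) := by
      intro j
      apply Real.log_le_log (by positivity)
      apply max_le_max le_rfl
      apply div_le_div_of_nonneg_left hs.le hδ
      linarith [norm_nonneg (j - a)]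
    have hψlim := tendsto_integral_of_bounded hμ ψ hψc _ hψ0 hψ1
    have hrhs : Tendsto (fun k : ℕ => s ^ 2 / (2 * l) + 1 / ((k : ℝ) + 1) / l +
        (1 / ((k : ℝ) + 1) + 1 / (N k : ℝ)) * Real.log (max 1 (s / δ))) u
        (𝓝 (s ^ 2 / (2 * l) + 0 / l + (0 + 0) * Real.log (max 1 (s / δ)))) :=
      (tendsto_const_nhds.add (hεlim.div_const l)).add ((hεlim.add hNlim).mul_const _)
    have hle := le_of_tendsto_of_tendsto hψlim hrhs (by
      filter_upwards [hnear] with k hk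
      obtain ⟨i, hi, hia⟩ := hk
      have h1 := sum_kernel_le (x k) (hx k) (I k) hl hs hδ (hI k) i a hia (hexc k i hi s hs)
      have h2 : ∫ y, ψ y ∂(P k : Measure ℂ) = (∑ j, ψ (x k j)) / N k :=
        integral_empiricalMeasure _ _
      rw [h2, div_le_iff₀ (hNr k)]
      refine h1.trans (le_of_eq ?_)
      have := (hNr k).ne'
      field_simp)
    rw [← ofReal_integral_eq_lintegral_ofReal _ (ae_of_all _ hψ0)]
    · apply ENNReal.ofReal_le_ofReal
      simpa using hle
    · refine Integrable.of_bound hψc.aestronglyMeasurable (Real.log (max 1 (s / δ)))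
        (ae_of_all _ fun y => ?_)
      rw [Real.norm_of_nonneg (hψ0 y)]; exact hψ1 y
  have hlt := hb μ inferInstance hexcl
  refine absurd hlt (not_lt.2 ?_)
  have hbd : ∀ n : ℕ, ∫⁻ y, ENNReal.ofReal (min (U y) n) ∂(μ : Measure ℂ) ≤ ENNReal.ofReal b := by
    intro n
    have hc : Continuous fun y => min (U y) (n : ℝ) := by fun_prop
    have h0 : ∀ y, 0 ≤ min (U y) (n : ℝ) := fun y => le_min (hU0 y) (Nat.cast_nonneg n)
    have h1 : ∀ y, min (U y) (n : ℝ) ≤ n := fun y => min_le_right _ _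
    have hlim := tendsto_integral_of_bounded hμ _ hc n h0 h1
    rw [← ofReal_integral_eq_lintegral_ofReal _ (ae_of_all _ h0)]
    · apply ENNReal.ofReal_le_ofReal
      refine le_of_tendsto hlim (Eventually.of_forall fun k => ?_)
      have h2 : ∫ y, min (U y) (n : ℝ) ∂(P k : Measure ℂ) = (∑ j, min (U (x k j)) (n : ℝ)) / N k :=
        integral_empiricalMeasure _ _
      rw [h2, div_le_iff₀ (hNr k), mul_comm]
      exact (Finset.sum_le_sum fun j _ => min_le_left _ _).trans (hUx k)
    · refine Integrable.of_bound hc.aestronglyMeasurable n (ae_of_all _ fun y => ?_)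
      rw [Real.norm_of_nonneg (h0 y)]; exact h1 y
  have hmono := lintegral_tendsto_of_tendsto_of_monotone (μ := (μ : Measure ℂ))
    (f := fun (n : ℕ) y => ENNReal.ofReal (min (U y) n)) (F := fun y => ENNReal.ofReal (U y))
    (fun n => by fun_prop)
    (ae_of_all _ fun y m n hmn => ENNReal.ofReal_le_ofReal
      (min_le_min le_rfl (by exact_mod_cast hmn)))
    (ae_of_all _ fun y => by
      apply tendsto_const_nhds.congr'
      obtain ⟨m, hm⟩ := exists_nat_ge (U y)
      filter_upwards [eventually_ge_atTop m] with n hn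
      rw [min_eq_left (hm.trans (by exact_mod_cast hn))])
  exact le_of_tendsto' hmono hbd

/-- The function is given by a polynomial of degree at most `d`. -/
def IsPolyOfDegreeLE (f : ℂ → ℂ) (d : ℕ) : Prop :=
  ∃ p : Polynomial ℂ, p.natDegree ≤ d ∧ ∀ y, f y = p.eval y

namespace IsPolyOfDegreeLE

lemma const (c : ℂ) (d : ℕ) : IsPolyOfDegreeLE (fun _ => c) d :=
  ⟨Polynomial.C c, by simp, by simp⟩

lemma mono {f : ℂ → ℂ} {d e : ℕ} (h : IsPolyOfDegreeLE f d) (hde : d ≤ e) :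
    IsPolyOfDegreeLE f e := by
  obtain ⟨p, hp, h⟩ := h
  exact ⟨p, hp.trans hde, h⟩

lemma mul {f g : ℂ → ℂ} {d e : ℕ} (hf : IsPolyOfDegreeLE f d) (hg : IsPolyOfDegreeLE g e) :
    IsPolyOfDegreeLE (fun y => f y * g y) (d + e) := by
  obtain ⟨p, hp, hf⟩ := hf
  obtain ⟨q, hq, hg⟩ := hg
  exact ⟨p * q, Polynomial.natDegree_mul_le.trans (add_le_add hp hq), by simp [hf, hg]⟩

lemma prod {ι : Type*} (s : Finset ι) {f : ι → ℂ → ℂ} {d : ι → ℕ}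
    (h : ∀ a ∈ s, IsPolyOfDegreeLE (f a) (d a)) :
    IsPolyOfDegreeLE (fun y => ∏ a ∈ s, f a y) (∑ a ∈ s, d a) := by
  classical
  induction s using Finset.induction_on with
  | empty => simpa using const 1 0
  | insert a s ha ih =>
    simp only [Finset.prod_insert ha, Finset.sum_insert ha]
    exact (h a (Finset.mem_insert_self a s)).mul
      (ih fun b hb => h b (Finset.mem_insert_of_mem hb))

lemma sum {ι : Type*} (s : Finset ι) {f : ι → ℂ → ℂ} {d : ℕ}
    (h : ∀ a ∈ s, IsPolyOfDegreeLE (f a) d) :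
    IsPolyOfDegreeLE (fun y => ∑ a ∈ s, f a y) d := by
  choose! p hp hf using h
  refine ⟨∑ a ∈ s, p a, Polynomial.natDegree_sum_le_of_forall_le s p hp, fun y => ?_⟩
  rw [Polynomial.eval_finsetSum]
  exact Finset.sum_congr rfl fun a ha => hf a ha y

lemma mvPolynomial_eval {σ : Type*} [Fintype σ] [DecidableEq σ] (f : MvPolynomial σ ℂ) (v : σ → ℂ)
    (i : σ) : IsPolyOfDegreeLE (fun y => MvPolynomial.eval (Function.update v i y) f)
      (f.degreeOf i) := by
  simp only [MvPolynomial.eval_eq']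
  refine sum _ fun m hm => ?_
  have hmi : m i ≤ f.degreeOf i := MvPolynomial.monomial_le_degreeOf i hm
  have h1 : IsPolyOfDegreeLE (fun y => ∏ j, Function.update v i y j ^ m j)
      (∑ j, if j = i then m i else 0) := by
    refine prod _ fun j _ => ?_
    by_cases hj : j = i
    · subst hj
      exact ⟨Polynomial.X ^ m j, by simp, by simp⟩
    · simp only [Function.update_of_ne hj, hj, if_false]
      exact const _ _
  have := (const (f.coeff m) 0).mul h1
  exact this.mono (by simpa using hmi)

end IsPolyOfDegreeLE

lemma sum_pairs_le {N : ℕ} (i : Fin N) (d : ℕ) :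
    ∑ a : Fin N, ∑ b ∈ Finset.Ioi a, (if a = i ∨ b = i then d else 0) ≤ 2 * (N * d) := by
  calc ∑ a : Fin N, ∑ b ∈ Finset.Ioi a, (if a = i ∨ b = i then d else 0)
      ≤ ∑ a : Fin N, ∑ b : Fin N, ((if a = i then d else 0) + (if b = i then d else 0)) := by
        refine Finset.sum_le_sum fun a _ => ?_
        refine (Finset.sum_le_sum_of_subset (Finset.subset_univ _)).trans
          (Finset.sum_le_sum fun b _ => ?_)
        by_cases ha : a = i <;> by_cases hb : b = i <;> simp [ha, hb]
    _ = 2 * (N * d) := by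
        simp [Finset.sum_add_distrib]
        ring

/-- A correlation factor is a polynomial of controlled degree in each variable. -/
lemma twoBodyFactors_coordinate {D : ℝ} (hD : 0 ≤ D) {N : ℕ} {F : (Fin N → ℂ) → ℂ}
    (hF : F ∈ twoBodyFactors D N) (z : Fin N → ℂ) (i : Fin N) :
    ∃ d : ℕ, (d : ℝ) ≤ 3 * D * N ∧
      IsPolyOfDegreeLE (fun y => F (Function.update z i y)) d := by
  obtain ⟨-, f₁, f₂, -, -, h1, h2, hF⟩ := hF
  refine ⟨f₁.natDegree + 2 * (N * ⌊D⌋₊), ?_, ?_⟩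
  · have := Nat.floor_le hD
    push_cast
    have hN : (0 : ℝ) ≤ N := Nat.cast_nonneg N
    nlinarith
  · simp only [hF]
    refine IsPolyOfDegreeLE.mul ?_ ?_
    · have := IsPolyOfDegreeLE.prod (Finset.univ : Finset (Fin N))
        (f := fun j y => f₁.eval (Function.update z i y j))
        (d := fun j => if j = i then f₁.natDegree else 0) (fun j _ => by
          by_cases hj : j = i
          · subst hj
            simpa using ⟨f₁, le_rfl, fun y => rfl⟩
          · simp only [Function.update_of_ne hj, hj, if_false]
            exact IsPolyOfDegreeLE.const _ _)
      simpa using this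
    · refine (IsPolyOfDegreeLE.prod (Finset.univ : Finset (Fin N))
        (d := fun a => ∑ b ∈ Finset.Ioi a, if a = i ∨ b = i then ⌊D⌋₊ else 0)
        fun a _ => ?_).mono (sum_pairs_le i _)
      refine IsPolyOfDegreeLE.prod _ fun b hb => ?_
      have hab : a ≠ b := (Finset.mem_Ioi.1 hb).ne
      have hdeg : ∀ k, f₂.degreeOf k ≤ ⌊D⌋₊ := fun k => Nat.le_floor (h2 k)
      by_cases ha : a = i
      · subst ha
        simp only [true_or, if_true, Function.update_self, Function.update_of_ne hab.symm]
        have h := (IsPolyOfDegreeLE.mvPolynomial_eval f₂ ![0, z b] 0).mono (hdeg 0)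
        have e : ∀ y : ℂ, Function.update ![0, z b] 0 y = ![y, z b] := by
          intro y; ext k; fin_cases k <;> simp
        simpa only [e] using h
      · by_cases hb' : b = i
        · subst hb'
          simp only [or_true, if_true, Function.update_self, Function.update_of_ne hab]
          have h := (IsPolyOfDegreeLE.mvPolynomial_eval f₂ ![z a, 0] 1).mono (hdeg 1)
          have e : ∀ y : ℂ, Function.update ![z a, 0] 1 y = ![z a, y] := by
            intro y; ext k; fin_cases k <;> simp
          simpa only [e] using h
        · simp only [Function.update_of_ne ha, Function.update_of_ne hb']
          exact IsPolyOfDegreeLE.const _ _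

lemma prod_Ioi_update {N : ℕ} (z : Fin N → ℂ) (i : Fin N) : ∃ κ : ℂ, ∀ y,
    ∏ a : Fin N, ∏ b ∈ Finset.Ioi a, (Function.update z i y a - Function.update z i y b) =
      κ * ∏ j ∈ Finset.univ.erase i, (y - z j) := by
  classical
  refine ⟨∏ a : Fin N, ∏ b ∈ Finset.Ioi a,
    (if a = i then 1 else if b = i then -1 else z a - z b), fun y => ?_⟩
  have h1 : ∏ j ∈ Finset.univ.erase i, (y - z j) =
      (∏ a : Fin N, ∏ b ∈ Finset.Ioi a, if a = i then (y - z b) else 1) *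
      ∏ a : Fin N, ∏ b ∈ Finset.Ioi a, if b = i then (y - z a) else 1 := by
    have e1 : (∏ a : Fin N, ∏ b ∈ Finset.Ioi a, if a = i then (y - z b) else 1) =
        ∏ b ∈ Finset.Ioi i, (y - z b) := by
      rw [Finset.prod_eq_single i]
      · simp
      · intro a _ ha; simp [ha]
      · simp
    have e2 : (∏ a : Fin N, ∏ b ∈ Finset.Ioi a, if b = i then (y - z a) else 1) =
        ∏ a ∈ Finset.Iio i, (y - z a) := by
      simp only [Finset.prod_ite_eq', Finset.mem_Ioi]
      rw [← Finset.prod_filter]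
      congr 1
      ext a; simp
    rw [e1, e2, ← Finset.prod_union]
    · congr 1
      ext a
      simp only [Finset.mem_erase, Finset.mem_univ, and_true, Finset.mem_union, Finset.mem_Ioi,
        Finset.mem_Iio]
      exact ⟨fun h => (lt_or_gt_of_ne h).symm, fun h => h.elim (fun h => h.ne') fun h => h.ne⟩
    · rw [Finset.disjoint_left]
      intro a ha hb
      exact lt_asymm (Finset.mem_Ioi.1 ha) (Finset.mem_Iio.1 hb)
  rw [h1]
  simp only [← Finset.prod_mul_distrib]
  refine Finset.prod_congr rfl fun a _ => Finset.prod_congr rfl fun b hb => ?_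
  have hab : a ≠ b := (Finset.mem_Ioi.1 hb).ne
  by_cases ha : a = i
  · subst ha
    simp [hab.symm]
  · by_cases hb' : b = i
    · subst hb'
      simp [hab]
    · simp [ha, hb', Function.update_of_ne]

lemma prod_Ioi_pow {N : ℕ} (z : Fin N → ℂ) (l : ℕ) :
    ∏ a : Fin N, ∏ b ∈ Finset.Ioi a, (z a - z b) ^ l =
      (∏ a : Fin N, ∏ b ∈ Finset.Ioi a, (z a - z b)) ^ l := by
  simp only [Finset.prod_pow]

lemma norm_prod_Ioi {N : ℕ} (z : Fin N → ℂ) :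
    ‖∏ a : Fin N, ∏ b ∈ Finset.Ioi a, (z a - z b)‖ = ‖(Matrix.vandermonde z).det‖ := by
  rw [Matrix.det_vandermonde]
  simp only [norm_prod]
  exact Finset.prod_congr rfl fun a _ => Finset.prod_congr rfl fun b _ => norm_sub_rev _ _

lemma norm_prod_Ioi_perm {N : ℕ} (z : Fin N → ℂ) (σ : Equiv.Perm (Fin N)) :
    ‖∏ a : Fin N, ∏ b ∈ Finset.Ioi a, (z (σ a) - z (σ b))‖ =
      ‖∏ a : Fin N, ∏ b ∈ Finset.Ioi a, (z a - z b)‖ := by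
  rw [norm_prod_Ioi z, norm_prod_Ioi (fun j => z (σ j))]
  have : Matrix.vandermonde (fun j => z (σ j)) = (Matrix.vandermonde z).submatrix σ id := by
    ext a b; simp [Matrix.vandermonde_apply]
  rw [this, Matrix.det_permute, norm_mul]
  rcases Int.units_eq_one_or (Equiv.Perm.sign σ) with h | h <;> simp [h]

lemma gaussian_update {N : ℕ} (z : Fin N → ℂ) (i : Fin N) (y : ℂ) :
    gaussian N (Function.update z i y) =
      Real.exp (-∑ j ∈ Finset.univ.erase i, ‖z j‖ ^ 2 / 2) * Real.exp (-(‖y‖ ^ 2 / 2)) := by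
  rw [gaussian, ← Real.exp_add, ← Finset.add_sum_erase _ _ (Finset.mem_univ i)]
  congr 1
  have : ∑ j ∈ Finset.univ.erase i, ‖Function.update z i y j‖ ^ 2 / 2 =
      ∑ j ∈ Finset.univ.erase i, ‖z j‖ ^ 2 / 2 := by
    refine Finset.sum_congr rfl fun j hj => ?_
    rw [Function.update_of_ne (Finset.ne_of_mem_erase hj)]
  rw [this, Function.update_self]
  ring

section States

variable {l : ℕ} {D : ℝ} {N : ℕ} {Ψ : (Fin N → ℂ) → ℂ}

/-- A correlated state as a function of one variable. -/
lemma correlatedStates_coordinate (hD : 0 ≤ D) (hΨ : Ψ ∈ correlatedStates l D N) (z : Fin N → ℂ)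
    (i : Fin N) : ∃ q : Polynomial ℂ, (q.natDegree : ℝ) ≤ 3 * D * N ∧ ∀ y,
      ‖Ψ (Function.update z i y)‖ =
        ‖(∏ j ∈ Finset.univ.erase i, (y - z j) ^ l) * q.eval y‖ * Real.exp (-(‖y‖ ^ 2 / 2)) := by
  obtain ⟨F, hF, c, hc, -⟩ := hΨ
  obtain ⟨d, hd, p, hp, hFp⟩ := twoBodyFactors_coordinate hD hF z i
  beta_reduce at hFp
  obtain ⟨κ, hκ⟩ := prod_Ioi_update z i
  set A : ℂ := c * ((eLpNorm (laughlinUnnormalized l N) 2 volume).toReal : ℂ)⁻¹ * κ ^ l *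
    (Real.exp (-∑ j ∈ Finset.univ.erase i, ‖z j‖ ^ 2 / 2) : ℂ) with hA
  refine ⟨Polynomial.C A * p, ?_, fun y => ?_⟩
  · refine le_trans ?_ hd
    exact_mod_cast (Polynomial.natDegree_C_mul_le _ _).trans hp
  · have : Ψ (Function.update z i y) = ((∏ j ∈ Finset.univ.erase i, (y - z j) ^ l) *
        (Polynomial.C A * p).eval y) * (Real.exp (-(‖y‖ ^ 2 / 2)) : ℂ) := by
      rw [hc, laughlin, laughlinUnnormalized, prod_Ioi_pow, hκ, gaussian_update, hFp,
        Polynomial.eval_mul, Polynomial.eval_C, Finset.prod_pow, hA, mul_pow]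
      push_cast
      ring
    rw [this, norm_mul, Complex.norm_real, Real.norm_of_nonneg (Real.exp_nonneg _)]

lemma correlatedStates_gain (hD : 0 ≤ D) (hΨ : Ψ ∈ correlatedStates l D N) (z : Fin N → ℂ)
    (i : Fin N) (r : ℝ) (hr : 0 < r) : ∃ y, ‖Ψ z‖ * (∏ j ∈ Finset.univ.erase i,
      max 1 (r / ‖z i - z j‖) ^ l) * Real.exp (-(r ^ 2 / 2)) ≤ ‖Ψ (Function.update z i y)‖ := by
  obtain ⟨q, -, hq⟩ := correlatedStates_coordinate hD hΨ z i
  obtain ⟨y, hy⟩ := exists_sphere_gain (Finset.univ.erase i) z l (fun y => q.eval y)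
    q.differentiable (z i) hr
  refine ⟨y, ?_⟩
  have h := hq (z i)
  rw [Function.update_eq_self] at h
  rw [hq y, h]
  exact hy

lemma correlatedStates_continuous (hΨ : Ψ ∈ correlatedStates l D N) : Continuous Ψ := by
  obtain ⟨F, hF, c, hc, -⟩ := hΨ
  have hFc : Continuous F := hF.1.1.continuous
  rw [show Ψ = fun z => c * laughlin l N z * F z from funext hc]
  unfold laughlin laughlinUnnormalized gaussian
  fun_prop

lemma correlatedStates_symm (hΨ : Ψ ∈ correlatedStates l D N) (σ : Equiv.Perm (Fin N))
    (z : Fin N → ℂ) : ‖Ψ (fun j => z (σ j))‖ = ‖Ψ z‖ := by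
  obtain ⟨F, hF, c, hc, -⟩ := hΨ
  have hg : gaussian N (fun j => z (σ j)) = gaussian N z := by
    unfold gaussian
    rw [Equiv.sum_comp σ (fun j => ‖z j‖ ^ 2 / 2)]
  simp only [hc, laughlin, laughlinUnnormalized, hg, hF.1.2.1 σ z, norm_mul, prod_Ioi_pow, norm_pow]
  rw [norm_prod_Ioi_perm z σ]

lemma correlatedStates_injective (hl : 1 ≤ l) (hΨ : Ψ ∈ correlatedStates l D N) {z : Fin N → ℂ}
    (hz : 0 < ‖Ψ z‖) : Function.Injective z := by
  obtain ⟨F, hF, c, hc, -⟩ := hΨ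
  rw [← Matrix.det_vandermonde_ne_zero_iff]
  intro h0
  rw [← norm_eq_zero, ← norm_prod_Ioi, norm_eq_zero] at h0
  rw [hc, laughlin, laughlinUnnormalized, prod_Ioi_pow, h0, zero_pow (by omega)] at hz
  simp at hz

lemma correlatedStates_lintegral (hΨ : Ψ ∈ correlatedStates l D N) :
    ∫⁻ z, ENNReal.ofReal (‖Ψ z‖ ^ 2) = 1 := by
  obtain ⟨F, hF, c, hc, h⟩ := hΨ
  rw [eLpNorm_eq_lintegral_rpow_enorm_toReal (by norm_num) (by norm_num)] at h
  simp only [ENNReal.toReal_ofNat, ENNReal.rpow_ofNat] at h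
  have h2 := congrArg (fun t : ENNReal => t ^ (2 : ℝ)) h
  simp only [← ENNReal.rpow_mul] at h2
  norm_num at h2
  rw [← h2]
  congr 1 with z
  rw [ENNReal.ofReal_pow (norm_nonneg _), ofReal_norm]

lemma correlatedStates_measurable (hΨ : Ψ ∈ correlatedStates l D N) :
    Measurable fun z => ENNReal.ofReal (‖Ψ z‖ ^ 2) := by
  have := correlatedStates_continuous hΨ
  exact ENNReal.measurable_ofReal.comp (this.norm.pow 2).measurable

lemma correlatedStates_sq_le (hD : 0 ≤ D) (hΨ : Ψ ∈ correlatedStates l D N) (z : Fin N → ℂ) :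
    ENNReal.ofReal (‖Ψ z‖ ^ 2) ≤ subMeanConst ^ N := by
  have := le_pow_mul_lintegral (fun z => ENNReal.ofReal (‖Ψ z‖ ^ 2))
    (correlatedStates_measurable hΨ) subMeanConst (fun z i => by
      obtain ⟨q, -, hq⟩ := correlatedStates_coordinate hD hΨ z i
      have h := hq (z i)
      rw [Function.update_eq_self] at h
      simp only [hq, h]
      exact gaussian_subMean (fun y => (∏ j ∈ Finset.univ.erase i, (y - z j) ^ l) * q.eval y)
        (Differentiable.mul (Differentiable.fun_finsetProd fun j _ => by fun_prop)
          q.differentiable) (z i)) z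
  rwa [correlatedStates_lintegral hΨ, mul_one] at this

lemma correlatedStates_second_moment (hD : 0 ≤ D) (hΨ : Ψ ∈ correlatedStates l D N) (i : Fin N) :
    ∫⁻ z, ENNReal.ofReal (‖z i‖ ^ 2 * ‖Ψ z‖ ^ 2) ≤ ENNReal.ofReal ((3 * D + l) * N + 1) := by
  have hc := correlatedStates_continuous hΨ
  have h := lintegral_le_of_coordinate (fun z => ENNReal.ofReal (‖z i‖ ^ 2 * ‖Ψ z‖ ^ 2))
    (fun z => ENNReal.ofReal ((3 * D + l) * N + 1) * ENNReal.ofReal (‖Ψ z‖ ^ 2))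
    (ENNReal.measurable_ofReal.comp (((continuous_apply i).norm.pow 2).mul
      (hc.norm.pow 2)).measurable) ((correlatedStates_measurable hΨ).const_mul _) i (fun z => by
      obtain ⟨q, hd, hq⟩ := correlatedStates_coordinate hD hΨ z i
      simp only [Function.update_self]
      rw [lintegral_const_mul]
      · simp only [hq]
        set p : Polynomial ℂ :=
          (∏ j ∈ Finset.univ.erase i, (Polynomial.X - Polynomial.C (z j)) ^ l) * q with hp
        have hpe : ∀ y, (∏ j ∈ Finset.univ.erase i, (y - z j) ^ l) * q.eval y = p.eval y := by
          intro y
          simp [hp, Polynomial.eval_prod]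
        simp only [hpe]
        refine (lintegral_polynomial_second_moment p le_rfl).trans ?_
        gcongr
        have h1 : p.natDegree ≤ N * l + q.natDegree := by
          refine Polynomial.natDegree_mul_le.trans (Nat.add_le_add_right ?_ _)
          refine (Polynomial.natDegree_prod_le _ _).trans ?_
          refine (Finset.sum_le_card_nsmul _ _ l fun j _ => ?_).trans ?_
          · refine Polynomial.natDegree_pow_le.trans ?_
            simp
          · rw [smul_eq_mul]
            gcongr
            exact (Finset.card_le_univ _).trans (by simp)
        have h2 : (p.natDegree : ℝ) ≤ N * l + q.natDegree := by exact_mod_cast h1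
        linarith
      · exact (correlatedStates_measurable hΨ).comp (measurable_update z))
  rwa [lintegral_const_mul _ (correlatedStates_measurable hΨ), correlatedStates_lintegral hΨ,
    mul_one] at h

end States

/-- For a potential bounded below and a probability density, the extended integral is the integral
of the shifted potential minus the shift. -/
lemma extIntegral_mul_density (W ρ : ℂ → ℝ) (m : ℝ) (hW : Measurable W) (hm : 0 ≤ m)
    (hWm : ∀ x, 0 ≤ W x + m) (hρ : AEMeasurable ρ) (hρ0 : ∀ᵐ x, 0 ≤ ρ x)
    (hρ1 : ∫⁻ x, ENNReal.ofReal (ρ x) = 1) :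
    extIntegral (fun x => W x * ρ x) =
      ((∫⁻ x, ENNReal.ofReal ((W x + m) * ρ x) : ENNReal) : EReal) - (m : EReal) := by
  set P := ∫⁻ x, ENNReal.ofReal ((W x + m) * ρ x) with hP
  set a := ∫⁻ x, ENNReal.ofReal (W x * ρ x) with ha
  set a' := ∫⁻ x, ENNReal.ofReal (-(W x * ρ x)) with ha'
  have hmI : ∫⁻ x, ENNReal.ofReal (m * ρ x) = ENNReal.ofReal m := by
    simp only [ENNReal.ofReal_mul hm]
    rw [lintegral_const_mul'' _ hρ.ennreal_ofReal, hρ1, mul_one]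
  have ha'm : a' ≤ ENNReal.ofReal m := by
    rw [← hmI]
    refine lintegral_mono_ae ?_
    filter_upwards [hρ0] with x hx
    apply ENNReal.ofReal_le_ofReal
    nlinarith [hWm x]
  have hsum : P + a' = a + ENNReal.ofReal m := by
    rw [← hmI, hP, ha, ha', ← lintegral_add_left' (by fun_prop), ← lintegral_add_left' (by fun_prop)]
    refine lintegral_congr_ae ?_
    filter_upwards [hρ0] with x hx
    have h1 : 0 ≤ (W x + m) * ρ x := mul_nonneg (hWm x) hx
    have h2 : 0 ≤ m * ρ x := mul_nonneg hm hx
    rcases le_total 0 (W x * ρ x) with h | h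
    · rw [ENNReal.ofReal_of_nonpos (by linarith : -(W x * ρ x) ≤ 0), add_zero,
        ← ENNReal.ofReal_add h h2]
      ring_nf
    · rw [ENNReal.ofReal_of_nonpos h, zero_add, ← ENNReal.ofReal_add h1 (by linarith)]
      ring_nf
  have ha't : a' ≠ ⊤ := ne_top_of_le_ne_top ENNReal.ofReal_ne_top ha'm
  change (a : EReal) - (a' : EReal) = _
  by_cases hPt : P = ⊤
  · have hat : a = ⊤ := by
      rw [hPt, top_add] at hsum
      by_contra hcon
      exact (ENNReal.add_ne_top.2 ⟨hcon, ENNReal.ofReal_ne_top⟩) hsum.symm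
    rw [hPt, hat, ← EReal.coe_ennreal_toReal ha't, EReal.coe_ennreal_top, EReal.top_sub_coe,
      EReal.top_sub_coe]
  · have hat : a ≠ ⊤ := by
      intro hcon
      rw [hcon, top_add] at hsum
      exact (ENNReal.add_ne_top.2 ⟨hPt, ha't⟩) hsum
    have h := congrArg ENNReal.toReal hsum
    rw [ENNReal.toReal_add hPt ha't, ENNReal.toReal_add hat ENNReal.ofReal_ne_top,
      ENNReal.toReal_ofReal hm] at h
    rw [← EReal.coe_ennreal_toReal hat, ← EReal.coe_ennreal_toReal ha't,
      ← EReal.coe_ennreal_toReal hPt, ← EReal.coe_sub, ← EReal.coe_sub]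
    congr 1
    linarith

lemma lintegral_sqrt_scale {n : ℝ} (hn : 0 < n) (g : ℂ → ENNReal) :
    ∫⁻ x, ENNReal.ofReal n * g ((Real.sqrt n : ℂ) * x) = ∫⁻ z, g z := by
  have hs : Real.sqrt n ≠ 0 := (Real.sqrt_pos.2 hn).ne'
  have h1 := Measure.map_addHaar_smul (volume : Measure ℂ) hs
  have h2 : ∫⁻ z, g z ∂(Measure.map (Real.sqrt n • ·) (volume : Measure ℂ)) =
      ∫⁻ x, g ((Real.sqrt n : ℂ) * x) :=
    (Homeomorph.smulOfNeZero (Real.sqrt n) hs).measurableEmbedding.lintegral_map g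
  rw [h1, lintegral_smul_measure, Complex.finrank_real_complex, Real.sq_sqrt hn.le,
    abs_of_pos (by positivity)] at h2
  rw [lintegral_const_mul' _ _ ENNReal.ofReal_ne_top, ← h2, smul_eq_mul, ← mul_assoc,
    ← ENNReal.ofReal_mul hn.le, mul_inv_cancel₀ hn.ne', ENNReal.ofReal_one, one_mul]

section Density

variable {n : ℕ} {Ψ : (Fin (n + 1) → ℂ) → ℂ}

lemma continuous_cons : Continuous fun q : ℂ × (Fin n → ℂ) =>
    (Fin.cons q.1 q.2 : Fin (n + 1) → ℂ) := by
  refine continuous_pi fun i => ?_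
  refine Fin.cases ?_ (fun j => ?_) i
  · simpa using continuous_fst
  · simp only [Fin.cons_succ]
    exact (continuous_apply j).comp continuous_snd

lemma continuous_norm_sq_cons (hΨ : Continuous Ψ) (z : ℂ) :
    Continuous fun w : Fin n → ℂ => ‖Ψ (Fin.cons z w : Fin (n + 1) → ℂ)‖ ^ 2 :=
  (hΨ.comp (continuous_cons.comp (by fun_prop : Continuous fun w : Fin n → ℂ => (z, w)))).norm.pow 2

lemma oneBodyDensity_eq_toReal (hΨ : Continuous Ψ) (z : ℂ) : oneBodyDensity Ψ z =
    (∫⁻ w : Fin n → ℂ, ENNReal.ofReal (‖Ψ (Fin.cons z w : Fin (n + 1) → ℂ)‖ ^ 2)).toReal := by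
  exact integral_eq_lintegral_of_nonneg_ae (ae_of_all _ fun w => by positivity)
    (continuous_norm_sq_cons hΨ z).aestronglyMeasurable

lemma measurable_lintegral_cons (hΨ : Continuous Ψ) : Measurable fun z : ℂ =>
    ∫⁻ w : Fin n → ℂ, ENNReal.ofReal (‖Ψ (Fin.cons z w : Fin (n + 1) → ℂ)‖ ^ 2) := by
  have hc : Continuous fun q : ℂ × (Fin n → ℂ) =>
      ‖Ψ (Fin.cons q.1 q.2 : Fin (n + 1) → ℂ)‖ ^ 2 := (hΨ.comp continuous_cons).norm.pow 2
  exact (ENNReal.measurable_ofReal.comp hc.measurable).lintegral_prod_right'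

lemma measurable_oneBodyDensity (hΨ : Continuous Ψ) : Measurable (oneBodyDensity Ψ) := by
  rw [show oneBodyDensity Ψ = _ from funext (oneBodyDensity_eq_toReal hΨ)]
  exact (measurable_lintegral_cons hΨ).ennreal_toReal

/-- Integrals against the one-body density are integrals of functions of the first variable. -/
lemma lintegral_oneBodyDensity (hΨ : Continuous Ψ)
    (h1 : ∫⁻ z, ENNReal.ofReal (‖Ψ z‖ ^ 2) = 1) (g : ℂ → ENNReal) (hg : Measurable g) :
    ∫⁻ z, g z * ENNReal.ofReal (oneBodyDensity Ψ z) =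
      ∫⁻ z, g (z 0) * ENNReal.ofReal (‖Ψ z‖ ^ 2) := by
  have key : ∀ g : ℂ → ENNReal, Measurable g →
      ∫⁻ z, g (z 0) * ENNReal.ofReal (‖Ψ z‖ ^ 2) =
      ∫⁻ z, g z * ∫⁻ w : Fin n → ℂ, ENNReal.ofReal (‖Ψ (Fin.cons z w : Fin (n + 1) → ℂ)‖ ^ 2) := by
    intro g hg
    have hmp := (volume_preserving_piFinSuccAbove (fun _ : Fin (n + 1) => ℂ) 0).symm
    rw [← hmp.lintegral_comp_emb (MeasurableEquiv.measurableEmbedding _)]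
    have hcons : ∀ q : ℂ × (Fin n → ℂ),
        (MeasurableEquiv.piFinSuccAbove (fun _ : Fin (n + 1) => ℂ) 0).symm q =
          (Fin.cons q.1 q.2 : Fin (n + 1) → ℂ) := by
      intro q
      exact Fin.insertNth_zero' q.1 q.2
    simp only [hcons, Fin.cons_zero]
    have hm : Measurable fun q : ℂ × (Fin n → ℂ) =>
        ENNReal.ofReal (‖Ψ (Fin.cons q.1 q.2 : Fin (n + 1) → ℂ)‖ ^ 2) :=
      ENNReal.measurable_ofReal.comp ((hΨ.comp continuous_cons).norm.pow 2).measurable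
    have hgm : Measurable fun q : ℂ × (Fin n → ℂ) => g q.1 *
        ENNReal.ofReal (‖Ψ (Fin.cons q.1 q.2 : Fin (n + 1) → ℂ)‖ ^ 2) :=
      (hg.comp measurable_fst).mul hm
    rw [Measure.volume_eq_prod, lintegral_prod _ hgm.aemeasurable]
    congr 1 with z
    have hz : Measurable fun w : Fin n → ℂ =>
        ENNReal.ofReal (‖Ψ (Fin.cons z w : Fin (n + 1) → ℂ)‖ ^ 2) :=
      ENNReal.measurable_ofReal.comp (continuous_norm_sq_cons hΨ z).measurable
    exact lintegral_const_mul (μ := (volume : Measure (Fin n → ℂ))) (g z) hz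
  have hfin := key (fun _ => 1) measurable_const
  simp only [one_mul, h1] at hfin
  have hae := ae_lt_top (measurable_lintegral_cons hΨ) (by rw [← hfin]; exact ENNReal.one_ne_top)
  rw [key g hg]
  refine lintegral_congr_ae ?_
  filter_upwards [hae] with z hz
  rw [oneBodyDensity_eq_toReal hΨ, ENNReal.ofReal_toReal hz.ne]

lemma oneBodyDensity_nonneg (z : ℂ) : 0 ≤ oneBodyDensity Ψ z :=
  integral_nonneg fun w => by positivity

lemma scaledEnergy_eq (hn : 0 < n) (hΨ : Continuous Ψ)
    (h1 : ∫⁻ z, ENNReal.ofReal (‖Ψ z‖ ^ 2) = 1) (V : ℂ → ℝ) (hV : Measurable V) (m : ℝ)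
    (hm : 0 ≤ m) (hVm : ∀ x, 0 ≤ V x + m) :
    scaledEnergy V Ψ = ((∫⁻ z, ENNReal.ofReal (V (z 0 / (Real.sqrt n : ℂ)) + m) *
      ENNReal.ofReal (‖Ψ z‖ ^ 2) : ENNReal) : EReal) - (m : EReal) := by
  have hn' : (0 : ℝ) < n := by exact_mod_cast hn
  have hs : (Real.sqrt n : ℂ) ≠ 0 := by exact_mod_cast (Real.sqrt_pos.2 hn').ne'
  have hρm := measurable_oneBodyDensity hΨ
  have e1 : (((n + 1 : ℕ) : ℝ) - 1) = n := by push_cast; ring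
  have e2 : scaledEnergy V Ψ = extIntegral fun x =>
      V x * (n * oneBodyDensity Ψ ((Real.sqrt n : ℂ) * x)) := by
    unfold scaledEnergy
    congr 1 with x
    rw [e1]; ring
  rw [e2, extIntegral_mul_density V _ m hV hm hVm]
  · congr 2
    rw [← lintegral_oneBodyDensity hΨ h1 (fun z => ENNReal.ofReal (V (z / (Real.sqrt n : ℂ)) + m))
      (by fun_prop), ← lintegral_sqrt_scale hn' (fun z =>
        ENNReal.ofReal (V (z / (Real.sqrt n : ℂ)) + m) * ENNReal.ofReal (oneBodyDensity Ψ z))]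
    congr 1 with x
    rw [mul_div_cancel_left₀ x hs, ← ENNReal.ofReal_mul (hVm x), ← ENNReal.ofReal_mul hn'.le]
    congr 1; ring
  · exact (measurable_const.mul (hρm.comp (measurable_const_mul _))).aemeasurable
  · exact ae_of_all _ fun x => mul_nonneg hn'.le (oneBodyDensity_nonneg _)
  · have := lintegral_oneBodyDensity hΨ h1 (fun _ => 1) measurable_const
    simp only [one_mul, h1] at this
    rw [← this, ← lintegral_sqrt_scale hn' (fun z => ENNReal.ofReal (oneBodyDensity Ψ z))]
    simp only [ENNReal.ofReal_mul hn'.le]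

lemma lintegral_symm (hsymm : ∀ (σ : Equiv.Perm (Fin (n + 1))) z, ‖Ψ (fun j => z (σ j))‖ = ‖Ψ z‖)
    (g : ℂ → ENNReal) (j : Fin (n + 1)) :
    ∫⁻ z, g (z j) * ENNReal.ofReal (‖Ψ z‖ ^ 2) = ∫⁻ z, g (z 0) * ENNReal.ofReal (‖Ψ z‖ ^ 2) := by
  set σ := Equiv.swap 0 j with hσ
  have hmp := volume_measurePreserving_piCongrLeft (fun _ : Fin (n + 1) => ℂ) σ
  rw [← hmp.lintegral_comp_emb (MeasurableEquiv.measurableEmbedding _)]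
  have he : ∀ z : Fin (n + 1) → ℂ, MeasurableEquiv.piCongrLeft (fun _ : Fin (n + 1) => ℂ) σ z =
      fun k => z (σ k) := by
    intro z
    ext k
    have := Equiv.piCongrLeft_apply_apply (P := fun _ : Fin (n + 1) => ℂ) σ z (σ k)
    have hk : σ (σ k) = k := by simp [hσ]
    rw [hk] at this
    exact this
  congr 1 with z
  rw [he z, hsymm]
  simp [hσ]

lemma lintegral_sum_symm (hΨ : Continuous Ψ)
    (hsymm : ∀ (σ : Equiv.Perm (Fin (n + 1))) z, ‖Ψ (fun j => z (σ j))‖ = ‖Ψ z‖)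
    (g : ℂ → ℝ) (hg : Measurable g) (hg0 : ∀ x, 0 ≤ g x) :
    ∫⁻ z, ENNReal.ofReal (∑ j, g (z j)) * ENNReal.ofReal (‖Ψ z‖ ^ 2) =
      ((n + 1 : ℕ) : ENNReal) * ∫⁻ z, ENNReal.ofReal (g (z 0)) * ENNReal.ofReal (‖Ψ z‖ ^ 2) := by
  have hm : Measurable fun z => ENNReal.ofReal (‖Ψ z‖ ^ 2) :=
    ENNReal.measurable_ofReal.comp (hΨ.norm.pow 2).measurable
  have : ∀ z : Fin (n + 1) → ℂ, ENNReal.ofReal (∑ j, g (z j)) * ENNReal.ofReal (‖Ψ z‖ ^ 2) =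
      ∑ j, ENNReal.ofReal (g (z j)) * ENNReal.ofReal (‖Ψ z‖ ^ 2) := by
    intro z
    rw [ENNReal.ofReal_sum_of_nonneg fun j _ => hg0 _, Finset.sum_mul]
  simp only [this]
  rw [lintegral_finsetSum _ fun j _ => by fun_prop]
  simp only [lintegral_symm hsymm (fun x => ENNReal.ofReal (g x))]
  simp

end Density

section LargeDeviations

variable {l : ℕ} {D : ℝ}

/-- Configurations of too low potential energy have a weight of order at most `exp (-c N²)`. -/
lemma correlatedStates_le_of_low_potential (hl : 1 ≤ l) (hD : 0 ≤ D) (U : ℂ → ℝ) (b : ℝ)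
    {ε : ℝ} (hε : 0 < ε) {N₀ : ℕ}
    (hcore : ∀ N ≥ N₀, ∀ x : Fin N → ℂ, Function.Injective x → ∀ I : Finset (Fin N),
      ((N : ℝ) - I.card ≤ ε * N) →
      (∀ i ∈ I, ∀ s, 0 < s → ∑ j ∈ I.erase i, (l : ℝ) * Real.log (max 1 (s / ‖x i - x j‖)) ≤
        N * (s ^ 2 / 2) + ε * N) →
      N * b < ∑ j, U (x j)) {N : ℕ} (hN : N₀ ≤ N) (hN2 : 2 ≤ N) {Ψ : (Fin N → ℂ) → ℂ}
    (hΨ : Ψ ∈ correlatedStates l D N) {S : ℝ} (hS0 : 0 < S) (hS : ∀ z, ‖Ψ z‖ ≤ S) (z : Fin N → ℂ)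
    (hz : ∑ j, U (z j / (Real.sqrt ((N : ℝ) - 1) : ℂ)) ≤ N * b) :
    ‖Ψ z‖ ≤ Real.exp (-(ε ^ 2 * N ^ 2)) * S := by
  by_contra hcon
  push Not at hcon
  have hpos : 0 < ‖Ψ z‖ := lt_of_le_of_lt (by positivity) hcon
  have hNr : (2 : ℝ) ≤ N := by exact_mod_cast hN2
  obtain ⟨I, hI1, hI2⟩ := exists_exclusion_subset l (fun z => ‖Ψ z‖) S hS
    (fun z i r hr => correlatedStates_gain hD hΨ z i r hr) z hpos (ε ^ 2 * N ^ 2) (ε * N)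
    (by positivity) (by
      rw [Real.exp_neg] at hcon
      rwa [inv_mul_lt_iff₀ (Real.exp_pos _)] at hcon)
  set t := Real.sqrt ((N : ℝ) - 1) with ht
  have ht0 : 0 < t := Real.sqrt_pos.2 (by linarith)
  have htc : (t : ℂ) ≠ 0 := by exact_mod_cast ht0.ne'
  have hlow := hcore N hN (fun j => z j / (t : ℂ))
    (fun a c h => correlatedStates_injective hl hΨ hpos ((div_left_inj' htc).1 h)) I (by
      have hεN : 0 < ε * N := by positivity
      refine le_of_mul_le_mul_right (hI1.trans (le_of_eq ?_)) hεN
      ring) (fun i hi s hs => by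
      have h := hI2 i hi (t * s) (by positivity)
      have e : ∀ j, s / ‖z i / (t : ℂ) - z j / (t : ℂ)‖ = t * s / ‖z i - z j‖ := by
        intro j
        rw [← sub_div, norm_div, Complex.norm_real, Real.norm_of_nonneg ht0.le, div_div_eq_mul_div,
          mul_comm]
      simp only [e]
      refine h.trans ?_
      rw [mul_pow, ht, Real.sq_sqrt (by linarith)]
      nlinarith [sq_nonneg s])
  linarith

lemma measurable_low_potential {N : ℕ} (U : ℂ → ℝ) (hU : Measurable U) (t : ℂ) (b : ℝ) :
    MeasurableSet {z : Fin N → ℂ | ∑ j, U (z j / t) ≤ b} :=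
  measurableSet_le (Finset.measurable_sum _ fun j _ =>
    hU.comp (by fun_prop : Measurable fun z : Fin N → ℂ => z j / t)) measurable_const

/-- Total weight of the configurations far out. -/
lemma correlatedStates_tail (hD : 0 ≤ D) {N : ℕ} (hN : 1 ≤ N) {Ψ : (Fin N → ℂ) → ℂ}
    (hΨ : Ψ ∈ correlatedStates l D N) {L : ℝ} (hL : 0 < L) :
    ∫⁻ z in {z | L * N ^ 2 ≤ ∑ j, ‖z j‖ ^ 2}, ENNReal.ofReal (‖Ψ z‖ ^ 2) ≤
      ENNReal.ofReal ((3 * D + l + 1) / L) := by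
  have hNr : (1 : ℝ) ≤ N := by exact_mod_cast hN
  have hc := correlatedStates_continuous hΨ
  have h1 : ∫⁻ z, ENNReal.ofReal (∑ j, ‖z j‖ ^ 2 * ‖Ψ z‖ ^ 2) ≤
      ENNReal.ofReal (N * ((3 * D + l) * N + 1)) := by
    have : ∀ z : Fin N → ℂ, ENNReal.ofReal (∑ j, ‖z j‖ ^ 2 * ‖Ψ z‖ ^ 2) =
        ∑ j, ENNReal.ofReal (‖z j‖ ^ 2 * ‖Ψ z‖ ^ 2) := fun z =>
      ENNReal.ofReal_sum_of_nonneg fun j _ => by positivity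
    have hm : ∀ j, Measurable fun z : Fin N → ℂ => ENNReal.ofReal (‖z j‖ ^ 2 * ‖Ψ z‖ ^ 2) :=
      fun j => ENNReal.measurable_ofReal.comp
        (((continuous_apply j).norm.pow 2).mul (hc.norm.pow 2)).measurable
    simp only [this]
    rw [lintegral_finsetSum _ fun j _ => hm j]
    refine (Finset.sum_le_sum fun j _ => correlatedStates_second_moment hD hΨ j).trans ?_
    rw [Finset.sum_const, Finset.card_univ, Fintype.card_fin, nsmul_eq_mul,
      ENNReal.ofReal_mul (by positivity), ENNReal.ofReal_natCast]
  have hLN : 0 < L * (N : ℝ) ^ 2 := by positivity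
  have h2 : ENNReal.ofReal (L * N ^ 2) *
      ∫⁻ z in {z | L * N ^ 2 ≤ ∑ j, ‖z j‖ ^ 2}, ENNReal.ofReal (‖Ψ z‖ ^ 2) ≤
      ∫⁻ z, ENNReal.ofReal (∑ j, ‖z j‖ ^ 2 * ‖Ψ z‖ ^ 2) := by
    rw [← lintegral_const_mul _ (correlatedStates_measurable hΨ)]
    refine le_trans (setLIntegral_mono' ?_ fun z hz => ?_) (setLIntegral_le_lintegral _ _)
    · exact (isClosed_le continuous_const (by fun_prop)).measurableSet
    · rw [← ENNReal.ofReal_mul hLN.le, ← Finset.sum_mul]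
      exact ENNReal.ofReal_le_ofReal (mul_le_mul_of_nonneg_right hz (by positivity))
  have h3 := h2.trans h1
  rw [mul_comm, ← ENNReal.le_div_iff_mul_le (Or.inl (by simpa using hLN))
    (Or.inl ENNReal.ofReal_ne_top), ← ENNReal.ofReal_div_of_pos hLN] at h3
  refine h3.trans (ENNReal.ofReal_le_ofReal ?_)
  rw [div_le_div_iff₀ hLN hL]
  have : (N : ℝ) * ((3 * D + l) * N + 1) ≤ (3 * D + l + 1) * N ^ 2 := by nlinarith
  nlinarith

lemma volume_sum_sq_le {N : ℕ} {R : ℝ} (hR : 0 ≤ R) :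
    volume {z : Fin N → ℂ | ∑ j, ‖z j‖ ^ 2 ≤ R} ≤ ENNReal.ofReal ((Real.pi * R) ^ N) := by
  have hsub : {z : Fin N → ℂ | ∑ j, ‖z j‖ ^ 2 ≤ R} ⊆ Metric.closedBall 0 (Real.sqrt R) := by
    intro z hz
    rw [mem_closedBall_zero_iff, pi_norm_le_iff_of_nonneg (Real.sqrt_nonneg _)]
    intro j
    apply Real.le_sqrt_of_sq_le
    exact (Finset.single_le_sum (f := fun j => ‖z j‖ ^ 2) (fun i _ => by positivity)
      (Finset.mem_univ j)).trans hz
  refine (measure_mono hsub).trans (le_of_eq ?_)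
  rw [volume_pi_closedBall _ (Real.sqrt_nonneg _)]
  simp only [Complex.volume_closedBall, Finset.prod_const, Finset.card_univ, Fintype.card_fin]
  rw [ENNReal.ofReal_pow (by positivity)]
  congr 1
  rw [← ENNReal.ofReal_pow (Real.sqrt_nonneg _), Real.sq_sqrt hR, mul_comm,
    ENNReal.ofReal_mul Real.pi_pos.le, ← NNReal.coe_real_pi, ENNReal.ofReal_coe_nnreal]

lemma tendsto_large_deviation_bound {A c : ℝ} (hA : 0 ≤ A) (hc : 0 < c) :
    Tendsto (fun N : ℕ => (Real.exp (-(c * N)) * (A * N ^ 2)) ^ N) atTop (𝓝 0) := by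
  have h1 : Tendsto (fun N : ℕ => A * ((N : ℝ) ^ 2 * Real.exp (-c * N))) atTop (𝓝 (A * 0)) := by
    apply Tendsto.const_mul
    have := (Real.tendsto_pow_mul_exp_neg_atTop_nhds_zero 2).comp
      (Tendsto.const_mul_atTop hc tendsto_natCast_atTop_atTop)
    have h2 := this.const_mul ((c ^ 2)⁻¹)
    rw [mul_zero] at h2
    refine h2.congr fun N => ?_
    simp only [Function.comp]
    rw [mul_pow, neg_mul]
    field_simp
  rw [mul_zero] at h1
  have h2 := h1.eventually_le_const (show (0 : ℝ) < 1 / 2 by norm_num)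
  refine squeeze_zero' (Eventually.of_forall fun N => by positivity) ?_
    (tendsto_pow_atTop_nhds_zero_of_lt_one (show (0 : ℝ) ≤ 1 / 2 by norm_num) (by norm_num))
  filter_upwards [h2] with N hN
  apply pow_le_pow_left₀ (by positivity)
  refine le_trans (le_of_eq ?_) hN
  rw [neg_mul]; ring

/-- Configurations of too low potential energy have vanishing probability. -/
theorem eventually_low_potential_weight_le (hl : 1 ≤ l) (hD : 0 ≤ D) (U : ℂ → ℝ)
    (hU : Continuous U) (hU0 : ∀ y, 0 ≤ U y) (hUinf : Tendsto U (cocompact ℂ) atTop) (b : ℝ)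
    (hb : ∀ μ : Measure ℂ, IsProbabilityMeasure μ →
      μ ≤ ENNReal.ofReal (1 / (Real.pi * l)) • volume →
      ENNReal.ofReal b < ∫⁻ x, ENNReal.ofReal (U x) ∂μ) {η : ℝ} (hη : 0 < η) :
    ∀ᶠ N : ℕ in atTop, ∀ Ψ ∈ correlatedStates l D N,
      ∫⁻ z in {z | ∑ j, U (z j / (Real.sqrt ((N : ℝ) - 1) : ℂ)) ≤ N * b},
        ENNReal.ofReal (‖Ψ z‖ ^ 2) ≤ ENNReal.ofReal η := by
  obtain ⟨ε, hε, N₀, hcore⟩ := potential_lower_bound_of_exclusion U hU hU0 hUinf l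
    (by exact_mod_cast hl) b hb
  set C := max 1 subMeanConst.toReal with hC
  have hC1 : 1 ≤ C := le_max_left _ _
  set K := 3 * D + l + 1 with hK
  have hK0 : 0 < K := by positivity
  set L := 2 * K / η with hL
  have hL0 : 0 < L := by positivity
  have hlim := tendsto_large_deviation_bound (A := C ^ 2 * (Real.pi * L)) (c := 2 * ε ^ 2)
    (by positivity) (by positivity)
  filter_upwards [hlim.eventually_le_const (half_pos hη), eventually_ge_atTop N₀,
    eventually_ge_atTop 2] with N hN1 hN2 hN3 Ψ hΨ
  have hS : ∀ z, ‖Ψ z‖ ≤ C ^ N := by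
    intro z
    have h := correlatedStates_sq_le hD hΨ z
    rw [← ENNReal.ofReal_toReal subMeanConst_ne_top, ← ENNReal.ofReal_pow ENNReal.toReal_nonneg,
      ENNReal.ofReal_le_ofReal_iff (by positivity)] at h
    have h2 : ‖Ψ z‖ ^ 2 ≤ (C ^ N) ^ 2 := by
      refine h.trans ((pow_le_pow_left₀ ENNReal.toReal_nonneg (le_max_right 1 _) N).trans ?_)
      exact le_self_pow₀ (one_le_pow₀ hC1) (by norm_num)
    exact le_of_sq_le_sq h2 (by positivity)
  set B := {z : Fin N → ℂ | ∑ j, U (z j / (Real.sqrt ((N : ℝ) - 1) : ℂ)) ≤ N * b} with hB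
  set T := {z : Fin N → ℂ | L * N ^ 2 ≤ ∑ j, ‖z j‖ ^ 2} with hT
  set T' := {z : Fin N → ℂ | ∑ j, ‖z j‖ ^ 2 ≤ L * N ^ 2} with hT'
  have hBm : MeasurableSet B := measurable_low_potential U hU.measurable _ _
  have hT'm : MeasurableSet T' := (isClosed_le (by fun_prop) continuous_const).measurableSet
  have hsub : B ⊆ T ∪ (B ∩ T') := by
    intro z hz
    rcases le_total (L * (N : ℝ) ^ 2) (∑ j, ‖z j‖ ^ 2) with h | h
    · exact Or.inl h
    · exact Or.inr ⟨hz, h⟩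
  have h1 : ∫⁻ z in T, ENNReal.ofReal (‖Ψ z‖ ^ 2) ≤ ENNReal.ofReal (η / 2) := by
    refine (correlatedStates_tail hD (by omega) hΨ hL0).trans (ENNReal.ofReal_le_ofReal ?_)
    rw [← hK, hL]
    apply le_of_eq
    field_simp
  have h2 : ∫⁻ z in B ∩ T', ENNReal.ofReal (‖Ψ z‖ ^ 2) ≤ ENNReal.ofReal (η / 2) := by
    calc ∫⁻ z in B ∩ T', ENNReal.ofReal (‖Ψ z‖ ^ 2)
        ≤ ∫⁻ _ in B ∩ T', ENNReal.ofReal ((Real.exp (-(ε ^ 2 * N ^ 2)) * C ^ N) ^ 2) := by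
          refine setLIntegral_mono' (hBm.inter hT'm) fun z hz => ?_
          apply ENNReal.ofReal_le_ofReal
          exact pow_le_pow_left₀ (norm_nonneg _) (correlatedStates_le_of_low_potential hl hD U b hε
            hcore hN2 hN3 hΨ (by positivity) hS z hz.1) 2
      _ ≤ ENNReal.ofReal ((Real.exp (-(ε ^ 2 * N ^ 2)) * C ^ N) ^ 2) *
          ENNReal.ofReal ((Real.pi * (L * N ^ 2)) ^ N) := by
          rw [setLIntegral_const]
          gcongr
          exact (measure_mono Set.inter_subset_right).trans (volume_sum_sq_le (by positivity))
      _ = ENNReal.ofReal ((Real.exp (-(2 * ε ^ 2 * N)) * (C ^ 2 * (Real.pi * L) * N ^ 2)) ^ N) := by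
          rw [← ENNReal.ofReal_mul (by positivity)]
          congr 1
          have : Real.exp (-(ε ^ 2 * N ^ 2)) ^ 2 = Real.exp (-(2 * ε ^ 2 * N)) ^ N := by
            rw [← Real.exp_nat_mul, ← Real.exp_nat_mul]
            congr 1; push_cast; ring
          rw [mul_pow, this]
          simp only [mul_pow]
          ring
      _ ≤ ENNReal.ofReal (η / 2) := ENNReal.ofReal_le_ofReal hN1
  calc ∫⁻ z in B, ENNReal.ofReal (‖Ψ z‖ ^ 2)
      ≤ ∫⁻ z in T ∪ (B ∩ T'), ENNReal.ofReal (‖Ψ z‖ ^ 2) := lintegral_mono_set hsub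
    _ ≤ _ := lintegral_union_le _ _ _
    _ ≤ ENNReal.ofReal (η / 2) + ENNReal.ofReal (η / 2) := add_le_add h1 h2
    _ = ENNReal.ofReal η := by
        rw [← ENNReal.ofReal_add (by positivity) (by positivity)]; congr 1; ring

end LargeDeviations

/-- Measures bounded by `1 / (π l)` times Lebesgue measure compete in the bath-tub problem. -/
lemma lt_lintegral_of_lt_bathTubEnergy {V : ℂ → ℝ} (hV : Measurable V) {l : ℕ} {a m : ℝ}
    (hm : 0 ≤ m) (hVm : ∀ x, 0 ≤ V x + m) (ham : 0 ≤ a + m)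
    (ha : (a : EReal) < bathTubEnergy V l) (μ : Measure ℂ) (hμ : IsProbabilityMeasure μ)
    (hle : μ ≤ ENNReal.ofReal (1 / (Real.pi * l)) • volume) :
    ENNReal.ofReal (a + m) < ∫⁻ x, ENNReal.ofReal (V x + m) ∂μ := by
  by_contra hcon
  push Not at hcon
  have hac : μ ≪ volume := (Measure.absolutelyContinuous_of_le hle).trans
    Measure.smul_absolutelyContinuous
  have hpi := Real.pi_pos
  have hc0 : 0 ≤ 1 / (Real.pi * l) := by positivity
  have hrn : ∀ᵐ x, μ.rnDeriv volume x ≤ ENNReal.ofReal (1 / (Real.pi * l)) := by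
    refine ae_le_of_forall_setLIntegral_le_of_sigmaFinite (Measure.measurable_rnDeriv _ _)
      fun s _ _ => ?_
    refine (Measure.setLIntegral_rnDeriv_le s).trans ?_
    rw [setLIntegral_const]
    exact hle s
  set ρ : ℂ → ℝ := fun x => (μ.rnDeriv volume x).toReal with hρ
  have hρm : Measurable ρ := (Measure.measurable_rnDeriv _ _).ennreal_toReal
  have hofReal : ∀ᵐ x, ENNReal.ofReal (ρ x) = μ.rnDeriv volume x := by
    filter_upwards [Measure.rnDeriv_lt_top μ volume] with x hx
    exact ENNReal.ofReal_toReal hx.ne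
  have hone : ∫⁻ x, ENNReal.ofReal (ρ x) = 1 := by
    rw [lintegral_congr_ae hofReal, Measure.lintegral_rnDeriv hac, measure_univ]
  have hmem : ρ ∈ bathTubDensities l := by
    refine ⟨Measure.integrable_toReal_rnDeriv, ?_, ?_⟩
    · filter_upwards [hrn] with x hx
      exact ⟨ENNReal.toReal_nonneg, ENNReal.toReal_le_of_le_ofReal hc0 hx⟩
    · rw [hρ, Measure.integral_toReal_rnDeriv hac]
      simp
  have hE : bathTubEnergy V l ≤ extIntegral fun x => V x * ρ x := iInf₂_le ρ hmem
  rw [extIntegral_mul_density V ρ m hV hm hVm hρm.aemeasurable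
    (ae_of_all _ fun x => ENNReal.toReal_nonneg) hone] at hE
  have hP : ∫⁻ x, ENNReal.ofReal ((V x + m) * ρ x) = ∫⁻ x, ENNReal.ofReal (V x + m) ∂μ := by
    rw [← lintegral_rnDeriv_mul hac (by fun_prop)]
    refine lintegral_congr_ae ?_
    filter_upwards [hofReal] with x hx
    rw [ENNReal.ofReal_mul (hVm x), hx, mul_comm]
  rw [hP] at hE
  have h2 : ((∫⁻ x, ENNReal.ofReal (V x + m) ∂μ : ENNReal) : EReal) - (m : EReal) ≤ (a : EReal) := by
    refine (EReal.sub_le_sub (EReal.coe_ennreal_le_coe_ennreal_iff.2 hcon) le_rfl).trans ?_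
    rw [EReal.coe_ennreal_ofReal, max_eq_left ham, ← EReal.coe_sub]
    exact le_of_eq (by congr 1; ring)
  exact absurd (hE.trans h2) (not_le.2 ha)

lemma exists_lower_bound {V : ℂ → ℝ} (hV : Continuous V) (hlim : Tendsto V (cocompact ℂ) atTop) :
    ∃ m, 0 ≤ m ∧ ∀ x, 0 ≤ V x + m := by
  obtain ⟨x₀, hx₀⟩ := hV.exists_forall_le hlim
  refine ⟨|V x₀|, abs_nonneg _, fun x => ?_⟩
  have := hx₀ x
  have := neg_abs_le (V x₀)
  linarith

lemma tendsto_cocompact_of_tendsto_iInf {V : ℂ → ℝ}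
    (hV : Tendsto (fun R : ℝ => ⨅ (x : ℂ) (_ : R ≤ ‖x‖), (V x : EReal)) atTop (𝓝 ⊤)) :
    Tendsto V (cocompact ℂ) atTop := by
  rw [tendsto_atTop]
  intro M
  obtain ⟨R, hR⟩ := (hV.eventually (lt_mem_nhds (EReal.coe_lt_top M))).exists
  have h := tendsto_norm_cocompact_atTop (E := ℂ) |>.eventually_ge_atTop R
  filter_upwards [h] with x hx
  exact_mod_cast (hR.le.trans (iInf₂_le x hx))

/-- Lower bound for the energy of a state in terms of the probability of low potential energy. -/
lemma le_scaledEnergy {V : ℂ → ℝ} (hV : Continuous V) {l : ℕ} {D : ℝ} {N : ℕ} (hN : 2 ≤ N)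
    {Ψ : (Fin N → ℂ) → ℂ} (hΨ : Ψ ∈ correlatedStates l D N) {b m η : ℝ} (hm : 0 ≤ m)
    (hVm : ∀ x, 0 ≤ V x + m) (hb : 0 ≤ b) (hη : 0 ≤ η)
    (hweight : ∫⁻ z in {z | ∑ j, (V (z j / (Real.sqrt ((N : ℝ) - 1) : ℂ)) + m) ≤ N * b},
        ENNReal.ofReal (‖Ψ z‖ ^ 2) ≤ ENNReal.ofReal η) :
    ((b * (1 - η) - m : ℝ) : EReal) ≤ scaledEnergy V Ψ := by
  obtain ⟨n, rfl⟩ : ∃ n, N = n + 1 := ⟨N - 1, by omega⟩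
  have hc := correlatedStates_continuous hΨ
  have h1 := correlatedStates_lintegral hΨ
  have hmeas := correlatedStates_measurable hΨ
  have e1 : (((n + 1 : ℕ) : ℝ) - 1) = n := by push_cast; ring
  rw [e1] at hweight
  rw [scaledEnergy_eq (by omega) hc h1 V hV.measurable m hm hVm]
  set t : ℂ := (Real.sqrt n : ℂ)
  set B := {z : Fin (n + 1) → ℂ | ∑ j, (V (z j / t) + m) ≤ (n + 1 : ℕ) * b} with hB
  have hBm : MeasurableSet B :=
    measurable_low_potential (fun x => V x + m) (by fun_prop) t _
  have hcompl : ENNReal.ofReal (1 - η) ≤ ∫⁻ z in Bᶜ, ENNReal.ofReal (‖Ψ z‖ ^ 2) := by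
    rw [ENNReal.ofReal_sub _ hη, ENNReal.ofReal_one, tsub_le_iff_right, ← h1,
      ← lintegral_add_compl _ hBm, add_comm]
    gcongr
  have hsum := lintegral_sum_symm hc (correlatedStates_symm hΨ) (fun x => V (x / t) + m)
    (by fun_prop) (fun x => hVm _)
  have hlow : ENNReal.ofReal ((n + 1 : ℕ) * b) * ENNReal.ofReal (1 - η) ≤
      ∫⁻ z, ENNReal.ofReal (∑ j, (V (z j / t) + m)) * ENNReal.ofReal (‖Ψ z‖ ^ 2) := by
    calc ENNReal.ofReal ((n + 1 : ℕ) * b) * ENNReal.ofReal (1 - η)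
        ≤ ENNReal.ofReal ((n + 1 : ℕ) * b) * ∫⁻ z in Bᶜ, ENNReal.ofReal (‖Ψ z‖ ^ 2) := by gcongr
      _ = ∫⁻ z in Bᶜ, ENNReal.ofReal ((n + 1 : ℕ) * b) * ENNReal.ofReal (‖Ψ z‖ ^ 2) :=
          (lintegral_const_mul _ hmeas).symm
      _ ≤ ∫⁻ z in Bᶜ, ENNReal.ofReal (∑ j, (V (z j / t) + m)) * ENNReal.ofReal (‖Ψ z‖ ^ 2) := by
          refine setLIntegral_mono' hBm.compl fun z hz => ?_
          gcongr
          exact (not_le.1 (show ¬ ∑ j, (V (z j / t) + m) ≤ (n + 1 : ℕ) * b from hz)).le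
      _ ≤ _ := setLIntegral_le_lintegral _ _
  rw [hsum, ENNReal.ofReal_mul (Nat.cast_nonneg _), ENNReal.ofReal_natCast, mul_assoc,
    ENNReal.mul_le_mul_iff_right (by simp) (ENNReal.natCast_ne_top _),
    ← ENNReal.ofReal_mul hb] at hlow
  refine le_trans ?_ (EReal.sub_le_sub (EReal.coe_ennreal_le_coe_ennreal_iff.2 hlow) le_rfl)
  rw [EReal.coe_ennreal_ofReal, EReal.coe_sub]
  exact EReal.sub_le_sub (EReal.coe_le_coe_iff.2 (le_max_left _ _)) le_rfl

end LaughlinPhase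

end

open LaughlinPhase in
theorem theorem2p1 (V : ℂ → ℝ) (hV : ContDiff ℝ 2 V)
    (hV_inf : Tendsto (fun R : ℝ => ⨅ (x : ℂ) (_ : R ≤ ‖x‖), (V x : EReal)) atTop (𝓝 ⊤))
    (ℓ : ℕ) (hℓ : 1 ≤ ℓ) (D : ℝ) (hD : 0 ≤ D) :
    LaughlinPhase.bathTubEnergy V ℓ ≤
      liminf (fun N : ℕ => LaughlinPhase.groundEnergy V ℓ D N) atTop := by
  have hVc := hV.continuous
  have hlim := tendsto_cocompact_of_tendsto_iInf hV_inf
  refine le_of_forall_lt fun y hy => ?_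
  obtain ⟨a, hya, ha⟩ := EReal.lt_iff_exists_real_btwn.1 hy
  obtain ⟨a', hya', ha'⟩ := EReal.lt_iff_exists_real_btwn.1 hya
  have haa : a' < a := EReal.coe_lt_coe_iff.1 ha'
  obtain ⟨m₀, hm₀, hVm₀⟩ := exists_lower_bound hVc hlim
  set m := max m₀ (-a) with hm_def
  have hm : 0 ≤ m := hm₀.trans (le_max_left _ _)
  have hVm : ∀ x, 0 ≤ V x + m := fun x => (hVm₀ x).trans (by gcongr; exact le_max_left _ _)
  have ham : 0 ≤ a + m := by linarith [le_max_right m₀ (-a)]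
  have hcore := lt_lintegral_of_lt_bathTubEnergy hVc.measurable hm hVm ham ha
  set η := (a - a') / (a + m + 1) with hη_def
  have hη : 0 < η := div_pos (by linarith) (by linarith)
  have hηa : (a + m) * η ≤ a - a' := by
    rw [hη_def, mul_div_assoc', div_le_iff₀ (by linarith)]
    nlinarith
  refine lt_of_lt_of_le hya' (le_liminf_of_le (by isBoundedDefault) ?_)
  filter_upwards [eventually_low_potential_weight_le hℓ hD (fun x => V x + m) (by fun_prop) hVm
    (tendsto_atTop_add_const_right _ _ hlim) (a + m) hcore hη, eventually_ge_atTop 2] with N hN hN2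
  refine le_iInf₂ fun Ψ hΨ => ?_
  refine le_trans ?_ (le_scaledEnergy hVc hN2 hΨ hm hVm ham hη.le (hN Ψ hΨ))
  rw [EReal.coe_le_coe_iff]
  linarith
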